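/- Let $k$ be a field and let $A$ be a connected DG $k$-algebra, that is, a $\mathbb{Z}$-graded $k$-algebra with $A^i=0$ for $i<0$ and $A^0=k$, equipped with a $k$-linear differential $\partial_A$ of degree $1$ such that $\partial_A^2=0$ and $\partial_A(ab)=\partial_A(a)b+(-1)^{|a|}a\,\partial_A(b)$. Write $A^{\#}$ for its underlying graded algebra and $A^{op}$ for the opposite DG algebra, with the same differential and multiplication $a\cdot b=(-1)^{|a||b|}ba$. A DG free $A$-module is a direct sum $\bigoplus_{y\in Y}Ae_y$ with homogeneous $e_y$ and $\partial(e_y)=0$. A semi-free filtration of a DG $A$-module $F$ is an increasing sequence of DG submodules $0=F(-1)\subseteq F(0)\subseteq F(1)\subseteq\cdots$ with union $F$ such that every $F(n)/F(n-1)$ is DG free; $F$ is semi-free if it has such a filtration. The filtration is strictly increasing if $F(n-1)\neq F(n)$ whenever $F(n-1)\neq F$, and its length is the least $n\ge 0$ with $F(n)=F$ (and $+\infty$ if there is none). The DG free class of $F$ is the least length of a strictly increasing semi-free filtration of $F$. The cone length $\mathrm{cl}_AM\in\mathbb{N}\cup\{+\infty\}$ of a DG $A$-module $M$ is the infimum of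 the DG free classes of all semi-free DG modules $F$ that admit a quasi-isomorphism $F\to M$. Put $$l.\mathrm{Gl.dim}A=\sup\{\mathrm{cl}_AM\mid M\text{ a DG }A\text{-module}\},\qquad r.\mathrm{Gl.dim}A=\sup\{\mathrm{cl}_{A^{op}}M\mid M\text{ a DG }A^{op}\text{-module}\}.$$ For a graded algebra $B$ let $\mathrm{gl.dim}B\in\mathbb{N}\cup\{+\infty\}$ be its graded global dimension, the supremum of the projective dimensions of all left graded $B$-modules in the category of left graded $B$-modules and morphisms of degree $0$. Suppose that $A$ has zero differential, $\partial_A=0$. Then $$l.\mathrm{Gl.dim}A=\mathrm{gl.dim}A^{\#}=r.\mathrm{Gl.dim}A ,$$ and moreover $\mathrm{gl.dim}(A^{op})^{\#}=\mathrm{gl.dim}A^{\#}$, so that it does not matter on which side the global dimension of $A^{\#}$ is taken. All these are equalities in $\mathbb{N}\cup\{+\infty\}$. -/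

import Mathlib

universe u v

/-- A `ℤ`-graded (associative, unital) algebra over a field `k`: a family `X i = A^i` of
`k`-vector spaces with `k`-bilinear multiplications `A^i × A^j → A^(i+j)`.  The target degree
is a variable `l` with a proof of `i + j = l`, so that no transport along equalities of degrees
is needed. -/
structure GradedAlg (k : Type v) [Field k] where
  X : ℤ → Type u
  [grp : ∀ i, AddCommGroup (X i)]
  [mod : ∀ i, Module k (X i)]
  mul : ∀ {i j l : ℤ}, i + j = l → (X i →ₗ[k] X j →ₗ[k] X l)
  one : X 0
  one_mul : ∀ {i : ℤ} (a : X i), mul (zero_add i) one a = a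
  mul_one : ∀ {i : ℤ} (a : X i), mul (add_zero i) a one = a
  mul_assoc : ∀ {i j l p q r : ℤ} (hp : i + j = p) (hr : p + l = r) (hq : j + l = q)
    (hr' : i + q = r) (a : X i) (b : X j) (c : X l),
    mul hr (mul hp a b) c = mul hr' a (mul hq b c)

attribute [instance] GradedAlg.grp GradedAlg.mod

/-- `A` is a connected graded algebra: `A^i = 0` for `i < 0` and `A^0 = k`, the latter meaning
that the structure map `k → A^0`, `c ↦ c • 1`, is bijective. -/
def GradedAlg.IsConnected {k : Type v} [Field k] (A : GradedAlg.{u} k) : Prop :=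
  (∀ i : ℤ, i < 0 → Subsingleton (A.X i)) ∧ Function.Bijective (fun c : k => c • A.one)

/-- A (left) graded module over the graded algebra `A`. -/
structure GradedMod {k : Type v} [Field k] (A : GradedAlg.{u} k) where
  X : ℤ → Type u
  [grp : ∀ i, AddCommGroup (X i)]
  [mod : ∀ i, Module k (X i)]
  smul : ∀ {i j l : ℤ}, i + j = l → (A.X i →ₗ[k] X j →ₗ[k] X l)
  one_smul : ∀ {i : ℤ} (m : X i), smul (zero_add i) A.one m = m
  mul_smul : ∀ {i j l p q r : ℤ} (hp : i + j = p) (hr : p + l = r) (hq : j + l = q)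
    (hr' : i + q = r) (a : A.X i) (b : A.X j) (m : X l),
    smul hr (A.mul hp a b) m = smul hr' a (smul hq b m)

attribute [instance] GradedMod.grp GradedMod.mod

/-- A morphism of graded `A`-modules (an `A`-linear map of degree `0`). -/
structure GradedModHom {k : Type v} [Field k] {A : GradedAlg.{u} k} (M N : GradedMod A) where
  map : ∀ i : ℤ, M.X i →ₗ[k] N.X i
  map_smul : ∀ {i j l : ℤ} (h : i + j = l) (a : A.X i) (m : M.X j),
    map l (M.smul h a m) = N.smul h a (map j m)

/-- `P` is a projective object of the category of graded `A`-modules. -/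
def GradedMod.IsProjective {k : Type v} [Field k] {A : GradedAlg.{u} k} (P : GradedMod A) :
    Prop :=
  ∀ (M N : GradedMod A) (g : GradedModHom M N) (f : GradedModHom P N),
    (∀ i, Function.Surjective (g.map i)) →
      ∃ h : GradedModHom P M, ∀ i (x : P.X i), g.map i (h.map i x) = f.map i x

/-- An exact sequence `0 → P_n → ⋯ → P_1 → P_0 → M → 0` of graded `A`-modules in which every
`P_i` is projective. -/
structure ProjResolution {k : Type v} [Field k] {A : GradedAlg.{u} k} (M : GradedMod A)
    (n : ℕ) where
  P : ℕ → GradedMod A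
  proj : ∀ p, (P p).IsProjective
  δ : ∀ p, GradedModHom (P (p + 1)) (P p)
  ε : GradedModHom (P 0) M
  surj : ∀ i, Function.Surjective (ε.map i)
  exact_zero : ∀ i, Function.Exact ((δ 0).map i) (ε.map i)
  exact_succ : ∀ p i, Function.Exact ((δ (p + 1)).map i) ((δ p).map i)
  bounded : ∀ p, n < p → ∀ i, Subsingleton ((P p).X i)

/-- The projective dimension of `M` in the category of graded `A`-modules; it is `⊤` if there is
no finite projective resolution, and `0` for the zero module. -/
noncomputable def GradedMod.projDim {k : Type v} [Field k] {A : GradedAlg.{u} k}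
    (M : GradedMod A) : ℕ∞ :=
  ⨅ (n : ℕ) (_ : Nonempty (ProjResolution M n)), (n : ℕ∞)

/-- The (left) graded global dimension of a graded algebra. -/
noncomputable def GradedAlg.glDim {k : Type v} [Field k] (A : GradedAlg.{u} k) : ℕ∞ :=
  ⨆ M : GradedMod A, M.projDim

/-- A differential graded algebra over `k`: a graded algebra with a `k`-linear differential of
degree `1` that satisfies the Leibniz rule.  Its underlying graded algebra `A^#` is
`A.toGradedAlg`. -/
structure DGAlg (k : Type v) [Field k] extends GradedAlg.{u} k where
  d : ∀ {i j : ℤ}, i + 1 = j → (X i →ₗ[k] X j)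
  d_d : ∀ {i j l : ℤ} (h : i + 1 = j) (h' : j + 1 = l) (a : X i), d h' (d h a) = 0
  leibniz : ∀ {i j l i' j' l' : ℤ} (h : i + j = l) (hi : i + 1 = i') (hj : j + 1 = j')
    (hl : l + 1 = l') (h₁ : i' + j = l') (h₂ : i + j' = l') (a : X i) (b : X j),
    d hl (mul h a b) = mul h₁ (d hi a) b + i.negOnePow • mul h₂ a (d hj b)

/-- A DG algebra is connected if its underlying graded algebra is. -/
def DGAlg.IsConnected {k : Type v} [Field k] (A : DGAlg.{u} k) : Prop :=
  A.toGradedAlg.IsConnected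

/-- The opposite graded algebra, with multiplication `a · b = (-1)^(|a||b|) b a`. -/
def GradedAlg.op {k : Type v} [Field k] (A : GradedAlg.{u} k) : GradedAlg.{u} k where
  X := A.X
  mul := fun {i j _} h => (i * j).negOnePow • (A.mul ((add_comm j i).trans h)).flip
  one := A.one
  one_mul := by
    intro i a
    simp [A.mul_one]
  mul_one := by
    intro i a
    simp [A.one_mul]
  mul_assoc := by
    intro i j l p q r hp hr hq hr' a b c
    simp only [LinearMap.smul_apply, LinearMap.flip_apply, Units.smul_def, map_zsmul]
    rw [A.mul_assoc (q := p) _ _ (by omega) (by omega), smul_smul, smul_smul,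
      ← Units.val_mul, ← Units.val_mul, ← Int.negOnePow_add, ← Int.negOnePow_add]
    subst hp hq
    congr 3
    ring

/-- The opposite DG algebra `A^op`: the opposite graded algebra with the same differential. -/
def DGAlg.op {k : Type v} [Field k] (A : DGAlg.{u} k) : DGAlg.{u} k where
  toGradedAlg := A.toGradedAlg.op
  d := fun {_ _} h => A.d h
  d_d := fun {_ _ _} h h' a => A.d_d h h' a
  leibniz := by
    intro i j l i' j' l' h hi hj hl h₁ h₂ a b
    change A.d hl ((i * j).negOnePow • A.mul _ b a) =
      (i' * j).negOnePow • A.mul _ b (A.d hi a) +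
        i.negOnePow • ((i * j').negOnePow • A.mul _ (A.d hj b) a)
    have key := A.leibniz ((add_comm j i).trans h) hj hi hl ((add_comm j' i).trans h₂)
      ((add_comm j i').trans h₁) b a
    simp only [Units.smul_def, map_zsmul] at key ⊢
    rw [key, smul_add, smul_smul, smul_smul, ← Units.val_mul, ← Units.val_mul,
      ← Int.negOnePow_add, ← Int.negOnePow_add, add_comm]
    subst hi hj
    have e1 : (i + 1) * j = i * j + j := by ring
    have e2 : (i + i * (j + 1)).negOnePow = (i * j).negOnePow := by
      have : i + i * (j + 1) = i * j + (i + i) := by ring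
      rw [this, Int.negOnePow_add, Int.negOnePow_even (i + i) ⟨i, rfl⟩, mul_one]
    rw [e1, e2]
    rfl

/-- A (left) DG module over the DG algebra `A`. -/
structure DGMod {k : Type v} [Field k] (A : DGAlg.{u} k) extends GradedMod A.toGradedAlg where
  d : ∀ {i j : ℤ}, i + 1 = j → (X i →ₗ[k] X j)
  d_d : ∀ {i j l : ℤ} (h : i + 1 = j) (h' : j + 1 = l) (m : X i), d h' (d h m) = 0
  leibniz : ∀ {i j l i' j' l' : ℤ} (h : i + j = l) (hi : i + 1 = i') (hj : j + 1 = j')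
    (hl : l + 1 = l') (h₁ : i' + j = l') (h₂ : i + j' = l') (a : A.X i) (m : X j),
    d hl (smul h a m) = smul h₁ (A.d hi a) m + i.negOnePow • smul h₂ a (d hj m)

/-- A morphism of DG `A`-modules. -/
structure DGModHom {k : Type v} [Field k] {A : DGAlg.{u} k} (M N : DGMod A) extends
    GradedModHom M.toGradedMod N.toGradedMod where
  map_d : ∀ {i j : ℤ} (h : i + 1 = j) (m : M.X i), map j (M.d h m) = N.d h (map i m)

/-- The cocycles of degree `i`. -/
def DGMod.cocycles {k : Type v} [Field k] {A : DGAlg.{u} k} (M : DGMod A) (i : ℤ) :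
    Submodule k (M.X i) :=
  LinearMap.ker (M.d (rfl : i + 1 = i + 1))

/-- The coboundaries of degree `i`. -/
def DGMod.coboundaries {k : Type v} [Field k] {A : DGAlg.{u} k} (M : DGMod A) (i : ℤ) :
    Submodule k (M.X i) :=
  LinearMap.range (M.d (sub_add_cancel i 1))

/-- The cohomology `H^i(M)`. -/
abbrev DGMod.cohomology {k : Type v} [Field k] {A : DGAlg.{u} k} (M : DGMod A) (i : ℤ) :
    Type u :=
  M.cocycles i ⧸ (M.coboundaries i).submoduleOf (M.cocycles i)

/-- The map induced by a morphism of DG modules on cocycles. -/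
def DGModHom.cocyclesMap {k : Type v} [Field k] {A : DGAlg.{u} k} {M N : DGMod A}
    (f : DGModHom M N) (i : ℤ) : M.cocycles i →ₗ[k] N.cocycles i :=
  (f.map i).restrict (by
    intro x hx
    have hx' : M.d (rfl : i + 1 = i + 1) x = 0 := hx
    change N.d (rfl : i + 1 = i + 1) (f.map i x) = 0
    rw [← f.map_d, hx', map_zero])

/-- The map `H^i(f)` induced by a morphism `f` of DG modules on cohomology. -/
def DGModHom.cohomologyMap {k : Type v} [Field k] {A : DGAlg.{u} k} {M N : DGMod A}
    (f : DGModHom M N) (i : ℤ) : M.cohomology i →ₗ[k] N.cohomology i :=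
  Submodule.mapQ _ _ (f.cocyclesMap i) (by
    rintro ⟨x, hx⟩ ⟨y, hy⟩
    exact ⟨f.map _ y, by rw [← f.map_d, hy]; rfl⟩)

/-- A morphism of DG modules is a quasi-isomorphism if it is bijective on cohomology. -/
def DGModHom.IsQuasiIso {k : Type v} [Field k] {A : DGAlg.{u} k} {M N : DGMod A}
    (f : DGModHom M N) : Prop :=
  ∀ i, Function.Bijective (f.cohomologyMap i)

/-- The DG free module `A^(Y) = ⨁_{y ∈ Y} A e_y` on a graded set `Y`, with `|e_y| = deg y` and
`∂ e_y = 0`: its part of degree `i` is `⨁_{y ∈ Y} A^(i - deg y) e_y`.  (Up to isomorphism these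
are the direct sums of suspensions of `A`.) -/
noncomputable def DGAlg.free {k : Type v} [Field k] (A : DGAlg.{u} k) (Y : Type u)
    (deg : Y → ℤ) : DGMod A where
  X := fun i => DirectSum Y (fun y => A.X (i - deg y))
  smul := fun {i j l} h =>
    LinearMap.mk₂ k
      (fun a m => DirectSum.lmap
        (fun y => A.mul (show i + (j - deg y) = l - deg y by omega) a) m)
      (by intro a a' m; ext y; simp [DirectSum.lmap_apply])
      (by intro c a m; ext y; rw [DirectSum.smul_apply]; simp [DirectSum.lmap_apply])
      (by intro a m m'; simp)
      (by intro c a m; simp)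
  one_smul := by
    intro i m
    ext y
    simpa [DirectSum.lmap_apply] using A.one_mul (m y)
  mul_smul := by
    intro i j l p q r hp hr hq hr' a b m
    ext y
    simpa [DirectSum.lmap_apply] using A.mul_assoc hp _ (by omega) _ a b (m y)
  d := fun {i j} h =>
    DirectSum.lmap (fun y => A.d (show (i - deg y) + 1 = j - deg y by omega))
  d_d := by
    intro i j l h h' m
    ext y
    simpa [DirectSum.lmap_apply] using A.d_d _ _ (m y)
  leibniz := by
    intro i j l i' j' l' h hi hj hl h₁ h₂ a m
    ext y
    simp only [Units.smul_def]
    rw [DirectSum.add_apply, ← Int.cast_smul_eq_zsmul k, DirectSum.smul_apply,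
      Int.cast_smul_eq_zsmul]
    simpa [DirectSum.lmap_apply, Units.smul_def] using
      A.leibniz _ hi (show (j - deg y) + 1 = j' - deg y by omega) _ _ _ a (m y)

/-- A DG submodule of a DG module. -/
@[ext]
structure DGSubmod {k : Type v} [Field k] {A : DGAlg.{u} k} (M : DGMod A) where
  X : ∀ i : ℤ, Submodule k (M.X i)
  smul_mem : ∀ {i j l : ℤ} (h : i + j = l) (a : A.X i) (m : M.X j), m ∈ X j → M.smul h a m ∈ X l
  d_mem : ∀ {i j : ℤ} (h : i + 1 = j) (m : M.X i), m ∈ X i → M.d h m ∈ X j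

/-- The zero DG submodule. -/
def DGSubmod.zero {k : Type v} [Field k] {A : DGAlg.{u} k} (M : DGMod A) : DGSubmod M where
  X := fun _ => ⊥
  smul_mem := by
    intro i j l h a m hm
    rw [Submodule.mem_bot] at hm ⊢
    rw [hm, map_zero]
  d_mem := by
    intro i j h m hm
    rw [Submodule.mem_bot] at hm ⊢
    rw [hm, map_zero]

/-- The whole module as a DG submodule. -/
def DGSubmod.whole {k : Type v} [Field k] {A : DGAlg.{u} k} (M : DGMod A) : DGSubmod M where
  X := fun _ => ⊤
  smul_mem := fun _ _ _ _ => trivial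
  d_mem := fun _ _ _ => trivial

/-- A DG submodule regarded as a DG module. -/
def DGSubmod.toDGMod {k : Type v} [Field k] {A : DGAlg.{u} k} {M : DGMod A}
    (N : DGSubmod M) : DGMod A where
  X := fun i => N.X i
  smul := fun {_ _ _} h =>
    LinearMap.mk₂ k (fun a m => ⟨M.smul h a m.1, N.smul_mem h a m.1 m.2⟩)
      (by intro a a' m; ext; simp)
      (by intro c a m; ext; simp)
      (by intro a m m'; ext; simp)
      (by intro c a m; ext; simp)
  one_smul := fun m => Subtype.ext (M.one_smul m.1)
  mul_smul := fun hp hr hq hr' a b m => Subtype.ext (M.mul_smul hp hr hq hr' a b m.1)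
  d := fun {_ _} h => (M.d h).restrict (fun m hm => N.d_mem h m hm)
  d_d := fun h h' m => Subtype.ext (M.d_d h h' m.1)
  leibniz := by
    intro i j l i' j' l' h hi hj hl h₁ h₂ a m
    apply Subtype.ext
    simpa [Units.smul_def] using M.leibniz h hi hj hl h₁ h₂ a m.1

/-- For DG submodules `N' ⊆ N` of `M`, the quotient `N / N'` is DG free: there is a surjective
morphism of DG modules from `N` onto some DG free module `A^(Y)` with kernel `N'`. -/
def DGSubmod.QuotientIsDGFree {k : Type v} [Field k] {A : DGAlg.{u} k} {M : DGMod A}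
    (N' N : DGSubmod M) : Prop :=
  ∃ (Y : Type u) (deg : Y → ℤ) (π : DGModHom N.toDGMod (A.free Y deg)),
    (∀ i, Function.Surjective (π.map i)) ∧
      ∀ i (x : N.X i), π.map i x = 0 ↔ (x : M.X i) ∈ N'.X i

/-- The term before the `n`-th one in a sequence `F(0), F(1), …` of DG submodules, where
`F(-1) = 0`. -/
def DGSubmod.prev {k : Type v} [Field k] {A : DGAlg.{u} k} {M : DGMod A}
    (F : ℕ → DGSubmod M) : ℕ → DGSubmod M
  | 0 => DGSubmod.zero M
  | n + 1 => F n

/-- A semi-free filtration `0 = F(-1) ⊆ F(0) ⊆ F(1) ⊆ ⋯` of a DG module `F`: an exhaustive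
increasing sequence of DG submodules with all `F(n) / F(n-1)` DG free. -/
structure SemifreeFiltration {k : Type v} [Field k] {A : DGAlg.{u} k} (F : DGMod A) where
  sub : ℕ → DGSubmod F
  mono : ∀ n i, (sub n).X i ≤ (sub (n + 1)).X i
  exhaustive : ∀ i (x : F.X i), ∃ n, x ∈ (sub n).X i
  quotient_free : ∀ n, DGSubmod.QuotientIsDGFree (DGSubmod.prev sub n) (sub n)

/-- A DG module is semi-free if it has a semi-free filtration. -/
def DGMod.IsSemifree {k : Type v} [Field k] {A : DGAlg.{u} k} (F : DGMod A) : Prop :=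
  Nonempty (SemifreeFiltration F)

/-- The filtration is strictly increasing: `F(n-1) ≠ F(n)` whenever `F(n-1) ≠ F`. -/
def SemifreeFiltration.IsStrict {k : Type v} [Field k] {A : DGAlg.{u} k} {F : DGMod A}
    (S : SemifreeFiltration F) : Prop :=
  ∀ n, DGSubmod.prev S.sub n ≠ DGSubmod.whole F → DGSubmod.prev S.sub n ≠ S.sub n

/-- The filtration has length `n`: `F(n) = F`, and `F(m) ≠ F` for `0 ≤ m < n`.  (The zero module
has length `0`.) -/
def SemifreeFiltration.HasLength {k : Type v} [Field k] {A : DGAlg.{u} k} {F : DGMod A}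
    (S : SemifreeFiltration F) (n : ℕ) : Prop :=
  S.sub n = DGSubmod.whole F ∧ ∀ m < n, S.sub m ≠ DGSubmod.whole F

/-- The DG free class of a semi-free DG module: the least length of its strictly increasing
semi-free filtrations, and `⊤` if none has finite length. -/
noncomputable def DGMod.dgFreeClass {k : Type v} [Field k] {A : DGAlg.{u} k} (F : DGMod A) :
    ℕ∞ :=
  ⨅ (n : ℕ) (_ : ∃ S : SemifreeFiltration F, S.IsStrict ∧ S.HasLength n), (n : ℕ∞)

/-- The cone length `cl_A M`: the infimum of the DG free classes of the semi-free resolutions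
`F → M`. -/
noncomputable def DGMod.coneLength {k : Type v} [Field k] {A : DGAlg.{u} k} (M : DGMod A) :
    ℕ∞ :=
  ⨅ (F : DGMod A) (_ : F.IsSemifree ∧ ∃ f : DGModHom F M, f.IsQuasiIso), F.dgFreeClass

/-- The left global dimension of a DG algebra: the supremum of the cone lengths of all its
(left) DG modules. -/
noncomputable def DGAlg.lGlDim {k : Type v} [Field k] (A : DGAlg.{u} k) : ℕ∞ :=
  ⨆ M : DGMod A, M.coneLength

/-- The right global dimension of a DG algebra: the supremum of the cone lengths of all DG
modules over the opposite DG algebra. -/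
noncomputable def DGAlg.rGlDim {k : Type v} [Field k] (A : DGAlg.{u} k) : ℕ∞ :=
  ⨆ M : DGMod A.op, M.coneLength

/-! Since `A` has zero differential, the sign `(-1)^i` turns the differential of a DG module into an
`A`-linear map `D` of degree `1`. Cocycles, coboundaries and cohomology are then graded `A`-modules.
Resolutions and filtrations are counted by their number of terms, so that length `n` means `n + 1`
terms.

Projective dimension is bounded by cone length. Let `F → N` be a quasi-isomorphism onto a graded
module with zero differential, where `F` has `n + 1` free layers. Each layer has zero differential,
so `D` carries each filtration step into the preceding one. As in the ghost lemma, the iterated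
extension class of `N` by its syzygies is represented on `F` by a map `κ` that kills one more layer
at each stage. At the last layer the obstruction is gone: the `n`-th syzygy is a direct summand of
its free cover, hence projective (`SyzygyComparison.succ`, `SyzygyComparison.isProjective`).

Cone length is bounded by the length of free resolutions. A free cover of `H(M)` is realised by a
morphism `L → M` from a DG free module, and the cohomology of its cone is, up to a shift, the first
syzygy of `H(M)`. Resolving the cone recursively and gluing `L` below gives a semi-free resolution
of `M` with one layer for each term of a free resolution of `H(M)` (`exists_cone_isCohomology`,
`exists_hasCells`).

It remains to replace projective resolutions by free ones of the same length, and to compare the two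
sides. The dual of a free `A^op`-module is an injective `A`-module. If `gl.dim A ≤ n`, dimension
shifting shows that `Ext^1(M, S^*) = 0` for all `M` when `S` is the `n`-th syzygy of an
`A^op`-module; for a minimal cover of `S` this forces the kernel to vanish
(`DualExtends.ker_isZero`). So bounded below `A^op`-modules have free resolutions with `n + 1`
terms, and a horseshoe argument along truncations extends this to all `A^op`-modules
(`hasFreeRes_of_filtration`). This gives `gl.dim A^op ≤ gl.dim A`; applied once more, from `A^op`
back to `A`, it gives equality and free resolutions over `A`. -/

section

open Function

/-! ### Graded algebras, modules and morphisms -/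

namespace GradedAlg

variable {k : Type v} [Field k]

/-- A graded algebra regarded as a DG algebra with zero differential. -/
def toDG (A : GradedAlg.{u} k) : DGAlg.{u} k where
  toGradedAlg := A
  d := fun _ => 0
  d_d := by simp
  leibniz := by simp

theorem mk_eq_of_mul_eq (A : GradedAlg.{u} k)
    {mul : ∀ {i j l : ℤ}, i + j = l → (A.X i →ₗ[k] A.X j →ₗ[k] A.X l)} (h₁ h₂ h₃)
    (e : @mul = @A.mul) : GradedAlg.mk A.X mul A.one h₁ h₂ h₃ = A := by
  subst e
  rfl

/-- The two signs `(-1)^(ij)` cancel. Equality of structures, rather than an isomorphism, allows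
statements over `A.op.op` to be rewritten as statements over `A`. -/
theorem op_op (A : GradedAlg.{u} k) : A.op.op = A := by
  refine mk_eq_of_mul_eq A A.op.op.one_mul A.op.op.mul_one A.op.op.mul_assoc ?_
  funext i j l h
  refine LinearMap.ext fun a => LinearMap.ext fun b => ?_
  change (i * j).negOnePow • ((j * i).negOnePow • A.mul h a b) = _
  rw [smul_smul, mul_comm j i, ← Int.negOnePow_add, Int.negOnePow_even _ ⟨_, rfl⟩, one_smul]
  rfl

theorem op_mul (A : GradedAlg.{u} k) {i j l : ℤ} (h : i + j = l) (h' : j + i = l) (a : A.X i)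
    (b : A.X j) : A.op.mul h a b = (i * j).negOnePow • A.mul h' b a := rfl

/-- The unit of `A` regarded as an element of `A.X i` when `i = 0`. -/
def unit (A : GradedAlg.{u} k) {i : ℤ} (h : i = 0) : A.X i := h.symm ▸ A.one

theorem mul_unit (A : GradedAlg.{u} k) {i j : ℤ} (hj : j = 0) (h : i + j = i) (a : A.X i) :
    A.mul h a (A.unit hj) = a := by
  subst hj
  exact A.mul_one a

theorem unit_mul (A : GradedAlg.{u} k) {i j : ℤ} (hi : i = 0) (h : i + j = j) (a : A.X j) :
    A.mul h (A.unit hi) a = a := by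
  subst hi
  exact A.one_mul a

end GradedAlg

variable {k : Type v} [Field k] {A : GradedAlg.{u} k}

theorem GradedMod.unit_smul (M : GradedMod A) {i j : ℤ} (hi : i = 0) (h : i + j = j)
    (m : M.X j) : M.smul h (A.unit hi) m = m := by
  subst hi
  exact M.one_smul m

namespace GradedModHom

/-- The identity morphism. -/
def id (M : GradedMod A) : GradedModHom M M where
  map := fun _ => LinearMap.id
  map_smul := fun _ _ _ => rfl

/-- The composite of two morphisms. -/
def comp {M N P : GradedMod A} (g : GradedModHom N P) (f : GradedModHom M N) :
    GradedModHom M P where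
  map := fun i => g.map i ∘ₗ f.map i
  map_smul := by
    intro i j l h a m
    simp [f.map_smul h, g.map_smul h]

@[simp] theorem comp_map {M N P : GradedMod A} (g : GradedModHom N P) (f : GradedModHom M N)
    (i : ℤ) (x : M.X i) : (g.comp f).map i x = g.map i (f.map i x) := rfl

/-- The zero morphism. -/
def zero (M N : GradedMod A) : GradedModHom M N where
  map := fun _ => 0
  map_smul := by simp

@[simp] theorem zero_map (M N : GradedMod A) (i : ℤ) (x : M.X i) :
    (zero M N).map i x = 0 := rfl

/-- The difference of two morphisms. -/
def sub {M N : GradedMod A} (f g : GradedModHom M N) : GradedModHom M N where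
  map := fun i => f.map i - g.map i
  map_smul := by
    intro i j l h a m
    simp [f.map_smul h, g.map_smul h]

@[simp] theorem sub_map {M N : GradedMod A} (f g : GradedModHom M N) (i : ℤ) (x : M.X i) :
    (f.sub g).map i x = f.map i x - g.map i x := rfl

end GradedModHom

/-- A graded submodule of a graded module. -/
structure GradedSubmod (M : GradedMod A) where
  X : ∀ i : ℤ, Submodule k (M.X i)
  smul_mem : ∀ {i j l : ℤ} (h : i + j = l) (a : A.X i) (m : M.X j), m ∈ X j → M.smul h a m ∈ X l

namespace GradedSubmod

variable {M : GradedMod A}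

/-- A graded submodule regarded as a graded module. -/
def toMod (N : GradedSubmod M) : GradedMod A where
  X := fun i => N.X i
  smul := fun {_ _ _} h =>
    LinearMap.mk₂ k (fun a m => ⟨M.smul h a m.1, N.smul_mem h a m.1 m.2⟩)
      (by intro a a' m; ext; simp)
      (by intro c a m; ext; simp)
      (by intro a m m'; ext; simp)
      (by intro c a m; ext; simp)
  one_smul := fun m => Subtype.ext (M.one_smul m.1)
  mul_smul := fun hp hr hq hr' a b m => Subtype.ext (M.mul_smul hp hr hq hr' a b m.1)

/-- The inclusion of a graded submodule. -/
def incl (N : GradedSubmod M) : GradedModHom N.toMod M where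
  map := fun i => (N.X i).subtype
  map_smul := fun _ _ _ => rfl

theorem incl_mem (N : GradedSubmod M) {i : ℤ} (x : N.toMod.X i) : N.incl.map i x ∈ N.X i := x.2

theorem incl_injective (N : GradedSubmod M) (i : ℤ) : Injective (N.incl.map i) :=
  Subtype.val_injective

/-- A morphism with values in a graded submodule, regarded as a morphism to it. -/
def codRestrict (N : GradedSubmod M) {P : GradedMod A} (f : GradedModHom P M)
    (hf : ∀ i x, f.map i x ∈ N.X i) : GradedModHom P N.toMod where
  map := fun i => (f.map i).codRestrict (N.X i) (hf i)
  map_smul := fun h a m => Subtype.ext (f.map_smul h a m)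

@[simp] theorem incl_codRestrict (N : GradedSubmod M) {P : GradedMod A} (f : GradedModHom P M)
    (hf : ∀ i x, f.map i x ∈ N.X i) (i : ℤ) (x : P.X i) :
    N.incl.map i ((N.codRestrict f hf).map i x) = f.map i x := rfl

/-- The quotient by a graded submodule. -/
def quot (N : GradedSubmod M) : GradedMod A where
  X := fun i => M.X i ⧸ N.X i
  smul := fun {_ j l} h =>
    LinearMap.mk₂ k (fun a => Submodule.mapQ (N.X j) (N.X l) (M.smul h a)
        (fun m hm => N.smul_mem h a m hm))
      (by rintro a a' ⟨m⟩; simp [Submodule.Quotient.quot_mk_eq_mk])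
      (by rintro c a ⟨m⟩; simp [Submodule.Quotient.quot_mk_eq_mk])
      (by intro a m m'; simp)
      (by intro c a m; simp)
  one_smul := by
    rintro i ⟨m⟩
    exact congrArg (Submodule.mkQ (N.X i)) (M.one_smul m)
  mul_smul := by
    rintro i j l p q r hp hr hq hr' a b ⟨m⟩
    exact congrArg (Submodule.mkQ (N.X r)) (M.mul_smul hp hr hq hr' a b m)

/-- The projection onto the quotient by a graded submodule. -/
def proj (N : GradedSubmod M) : GradedModHom M N.quot where
  map := fun i => (N.X i).mkQ
  map_smul := fun _ _ _ => rfl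

theorem proj_surjective (N : GradedSubmod M) (i : ℤ) : Surjective (N.proj.map i) :=
  Submodule.mkQ_surjective _

theorem proj_eq_zero (N : GradedSubmod M) {i : ℤ} (x : M.X i) :
    N.proj.map i x = 0 ↔ x ∈ N.X i :=
  Submodule.Quotient.mk_eq_zero _

end GradedSubmod

namespace GradedModHom

variable {M N : GradedMod A}

/-- The kernel of a morphism as a graded submodule. -/
def kerSub (f : GradedModHom M N) : GradedSubmod M where
  X := fun i => LinearMap.ker (f.map i)
  smul_mem := by
    intro i j l h a m hm
    rw [LinearMap.mem_ker] at hm ⊢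
    rw [f.map_smul h, hm, map_zero]

/-- The kernel of a morphism. -/
abbrev ker (f : GradedModHom M N) : GradedMod A := f.kerSub.toMod

/-- The inclusion of the kernel. -/
abbrev kerι (f : GradedModHom M N) : GradedModHom f.ker M := f.kerSub.incl

theorem map_kerι (f : GradedModHom M N) {i : ℤ} (x : f.ker.X i) :
    f.map i (f.kerι.map i x) = 0 := x.2

theorem exists_kerι_eq (f : GradedModHom M N) {i : ℤ} {x : M.X i} (hx : f.map i x = 0) :
    ∃ y : f.ker.X i, f.kerι.map i y = x := ⟨⟨x, hx⟩, rfl⟩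

/-- A morphism that vanishes on the kernel of a surjective morphism factors through it. -/
theorem exists_factor {P : GradedMod A} (g : GradedModHom M N)
    (hg : ∀ i, Surjective (g.map i)) (f : GradedModHom M P)
    (hf : ∀ i x, g.map i x = 0 → f.map i x = 0) :
    ∃ h : GradedModHom N P, ∀ i x, h.map i (g.map i x) = f.map i x := by
  have key : ∀ i, ∃ h : N.X i →ₗ[k] P.X i, h ∘ₗ g.map i = f.map i := by
    intro i
    obtain ⟨s, hs⟩ := (g.map i).exists_rightInverse_of_surjective
      (LinearMap.range_eq_top.2 (hg i))
    refine ⟨f.map i ∘ₗ s, ?_⟩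
    ext x
    have h1 : g.map i (s (g.map i x) - x) = 0 := by
      rw [map_sub, sub_eq_zero]
      exact LinearMap.congr_fun hs _
    have h2 := hf i _ h1
    rw [map_sub, sub_eq_zero] at h2
    exact h2
  choose h hh using key
  have hh' : ∀ i x, h i (g.map i x) = f.map i x := fun i x => LinearMap.congr_fun (hh i) x
  refine ⟨⟨h, ?_⟩, hh'⟩
  intro i j l e a m
  obtain ⟨m, rfl⟩ := hg j m
  rw [← g.map_smul e, hh', hh', f.map_smul e]

/-- A morphism whose values lie in the image of an injective morphism lifts along it. -/
theorem exists_lift_injective {P : GradedMod A} (g : GradedModHom M N)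
    (hg : ∀ i, Injective (g.map i)) (f : GradedModHom P N)
    (hf : ∀ i x, ∃ y, g.map i y = f.map i x) :
    ∃ h : GradedModHom P M, ∀ i x, g.map i (h.map i x) = f.map i x := by
  choose h hh using hf
  refine ⟨⟨fun i => ⟨⟨h i, ?_⟩, ?_⟩, ?_⟩, hh⟩
  · intro x y
    apply hg i
    rw [map_add, hh, hh, hh, map_add]
  · intro c x
    apply hg i
    simp [hh]
  · intro i j l e a m
    apply hg l
    change g.map l (h l _) = g.map l (M.smul e a (h j m))
    rw [g.map_smul e, hh, hh, f.map_smul e]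

end GradedModHom

/-! ### Linear maps of arbitrary degree -/

/-- An `A`-linear map of degree `p` (without signs). -/
structure DegHom (p : ℤ) (M N : GradedMod A) where
  map : ∀ {i j : ℤ}, i + p = j → (M.X i →ₗ[k] N.X j)
  map_smul : ∀ {i j l j' l' : ℤ} (h : i + j = l) (hj : j + p = j') (hl : l + p = l')
    (h' : i + j' = l') (a : A.X i) (m : M.X j),
    map hl (M.smul h a m) = N.smul h' a (map hj m)

namespace DegHom

variable {L M N P : GradedMod A} {p : ℤ}

/-- The zero map of degree `p`. -/
def zero (p : ℤ) (M N : GradedMod A) : DegHom p M N where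
  map := fun _ => 0
  map_smul := by simp

@[simp] theorem zero_map {i j : ℤ} (h : i + p = j) (x : M.X i) : (zero p M N).map h x = 0 := rfl

/-- The sum of two maps. -/
def add (f g : DegHom p M N) : DegHom p M N where
  map := fun h => f.map h + g.map h
  map_smul := by
    intro i j l j' l' h hj hl h' a m
    simp [f.map_smul h hj hl h', g.map_smul h hj hl h']

@[simp] theorem add_map (f g : DegHom p M N) {i j : ℤ} (h : i + p = j) (x : M.X i) :
    (f.add g).map h x = f.map h x + g.map h x := rfl

/-- The difference of two maps. -/
def sub (f g : DegHom p M N) : DegHom p M N where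
  map := fun h => f.map h - g.map h
  map_smul := by
    intro i j l j' l' h hj hl h' a m
    simp [f.map_smul h hj hl h', g.map_smul h hj hl h']

@[simp] theorem sub_map (f g : DegHom p M N) {i j : ℤ} (h : i + p = j) (x : M.X i) :
    (f.sub g).map h x = f.map h x - g.map h x := rfl

/-- The composite of a map of degree `p` with a morphism. -/
def postcomp (g : GradedModHom N P) (f : DegHom p M N) : DegHom p M P where
  map := fun {_ j} h => g.map j ∘ₗ f.map h
  map_smul := by
    intro i j l j' l' h hj hl h' a m
    simp [f.map_smul h hj hl h', g.map_smul h']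

@[simp] theorem postcomp_map (g : GradedModHom N P) (f : DegHom p M N) {i j : ℤ}
    (h : i + p = j) (x : M.X i) : (postcomp g f).map h x = g.map j (f.map h x) := rfl

/-- The composite of a morphism with a map of degree `p`. -/
def precomp (f : DegHom p M N) (g : GradedModHom L M) : DegHom p L N where
  map := fun {i _} h => f.map h ∘ₗ g.map i
  map_smul := by
    intro i j l j' l' h hj hl h' a m
    simp [f.map_smul h hj hl h', g.map_smul h]

@[simp] theorem precomp_map (f : DegHom p M N) (g : GradedModHom L M) {i j : ℤ}
    (h : i + p = j) (x : L.X i) : (f.precomp g).map h x = f.map h (g.map i x) := rfl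

/-- The composite of two maps. -/
def comp {q r : ℤ} (g : DegHom q N P) (f : DegHom p M N) (e : p + q = r) : DegHom r M P where
  map := fun {i j} h => g.map (show i + p + q = j by omega) ∘ₗ f.map rfl
  map_smul := by
    intro i j l j' l' h hj hl h' a m
    simp only [LinearMap.comp_apply]
    rw [f.map_smul h rfl rfl (by omega), g.map_smul _ _ _ h']

theorem comp_map {q r : ℤ} (g : DegHom q N P) (f : DegHom p M N) (e : p + q = r) {i j l : ℤ}
    (h : i + r = l) (h₁ : i + p = j) (h₂ : j + q = l) (x : M.X i) :
    (g.comp f e).map h x = g.map h₂ (f.map h₁ x) := by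
  subst h₁
  rfl

/-- A map with values in a graded submodule. -/
def codRestrict (S : GradedSubmod N) (f : DegHom p M N)
    (hf : ∀ {i j} (h : i + p = j) x, f.map h x ∈ S.X j) : DegHom p M S.toMod where
  map := fun {_ j} h => (f.map h).codRestrict (S.X j) (hf h)
  map_smul := fun h hj hl h' a m => Subtype.ext (f.map_smul h hj hl h' a m)

@[simp] theorem incl_codRestrict (S : GradedSubmod N) (f : DegHom p M N)
    (hf : ∀ {i j} (h : i + p = j) x, f.map h x ∈ S.X j) {i j : ℤ} (h : i + p = j) (x : M.X i) :
    S.incl.map j ((f.codRestrict S hf).map h x) = f.map h x := rfl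

end DegHom

/-- A morphism regarded as a map of degree `0`. -/
def GradedModHom.toDegHom {M N : GradedMod A} (f : GradedModHom M N) : DegHom 0 M N where
  -- Acting by the unit identifies `N.X i` with `N.X j` when `i + 0 = j`, in place of a cast.
  map := fun {i j} h => N.smul (show 0 + i = j by omega) A.one ∘ₗ f.map i
  map_smul := by
    intro i j l j' l' h hj hl h' a m
    obtain rfl : j = j' := by omega
    obtain rfl : l = l' := by omega
    simp only [LinearMap.comp_apply]
    rw [N.one_smul, N.one_smul, f.map_smul]

theorem GradedModHom.toDegHom_map {M N : GradedMod A} (f : GradedModHom M N) {i : ℤ}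
    (h : i + 0 = i) (x : M.X i) : f.toDegHom.map h x = f.map i x :=
  N.one_smul _

/-- A map of degree `0` regarded as a morphism. -/
def DegHom.toHom {M N : GradedMod A} (f : DegHom 0 M N) : GradedModHom M N where
  map := fun i => f.map (add_zero i)
  map_smul := fun h a m => f.map_smul h _ _ h a m

/-! ### Free graded modules -/

namespace GradedAlg

/-- The graded free module on a graded set. -/
noncomputable abbrev free (A : GradedAlg.{u} k) (Y : Type u) (deg : Y → ℤ) : GradedMod A :=
  (A.toDG.free Y deg).toGradedMod

variable {Y : Type u} {deg : Y → ℤ}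

open Classical in
/-- The inclusion of the summand `A e_y`. -/
noncomputable def ofFree (deg : Y → ℤ) (y : Y) (i : ℤ) :
    A.X (i - deg y) →ₗ[k] (A.free Y deg).X i :=
  DirectSum.lof k Y (fun y => A.X (i - deg y)) y

theorem free_smul_ofFree {i j l : ℤ} (h : i + j = l) (y : Y) (a : A.X i)
    (b : A.X (j - deg y)) :
    (A.free Y deg).smul h a (ofFree deg y j b) =
      ofFree deg y l (A.mul (by omega) a b) := by
  classical
  exact DirectSum.lmap_lof (fun y => A.mul (show i + (j - deg y) = l - deg y by omega) a) y b

theorem free_linearMap_ext {V : Type*} [AddCommGroup V] [Module k V] {i : ℤ}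
    {f g : (A.free Y deg).X i →ₗ[k] V}
    (h : ∀ y a, f (ofFree deg y i a) = g (ofFree deg y i a)) : f = g := by
  classical
  exact DirectSum.linearMap_ext k fun y => LinearMap.ext fun a => h y a

/-- The basis element `e_y`. -/
noncomputable def freeBasis (A : GradedAlg.{u} k) (deg : Y → ℤ) (y : Y) :
    (A.free Y deg).X (deg y) :=
  ofFree deg y (deg y) (A.unit (sub_self _))

theorem smul_freeBasis {i j : ℤ} (y : Y) (h : i + deg y = j) (h' : i = j - deg y) (a : A.X i) :
    (A.free Y deg).smul h a (freeBasis A deg y) = ofFree deg y j (h' ▸ a) := by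
  subst h'
  rw [freeBasis, free_smul_ofFree, A.mul_unit]

theorem ofFree_eq {i : ℤ} (y : Y) (a : A.X (i - deg y)) :
    ofFree deg y i a = (A.free Y deg).smul (by omega) a (freeBasis A deg y) :=
  (smul_freeBasis y _ rfl a).symm

open Classical in
/-- The `k`-linear map underlying `freeDegHom`. -/
noncomputable def freeDegMap {M : GradedMod A} (p : ℤ) {d : Y → ℤ}
    (hd : ∀ y, deg y + p = d y) (x : ∀ y, M.X (d y)) {i j : ℤ} (h : i + p = j) :
    (A.free Y deg).X i →ₗ[k] M.X j :=
  DirectSum.toModule k Y (M.X j)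
    (fun y => (M.smul (show i - deg y + d y = j by have := hd y; omega)).flip (x y))

theorem freeDegMap_ofFree {M : GradedMod A} (p : ℤ) {d : Y → ℤ}
    (hd : ∀ y, deg y + p = d y) (x : ∀ y, M.X (d y)) {i j : ℤ} (h : i + p = j) (y : Y)
    (h' : i - deg y + d y = j) (a : A.X (i - deg y)) :
    freeDegMap p hd x h (ofFree deg y i a) = M.smul h' a (x y) := by
  classical
  exact DirectSum.toModule_lof (φ := fun y =>
    (M.smul (show i - deg y + d y = j by have := hd y; omega)).flip (x y)) k y a

/-- The map of degree `p` out of a free module with prescribed values on the basis. -/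
noncomputable def freeDegHom {M : GradedMod A} (p : ℤ) {d : Y → ℤ}
    (hd : ∀ y, deg y + p = d y) (x : ∀ y, M.X (d y)) : DegHom p (A.free Y deg) M where
  map := fun {i j} h => freeDegMap p hd x h
  map_smul := by
    intro i j l j' l' h hj hl h' a m
    refine LinearMap.congr_fun (f := freeDegMap p hd x hl ∘ₗ (A.free Y deg).smul h a)
      (g := M.smul h' a ∘ₗ freeDegMap p hd x hj) (free_linearMap_ext fun y b => ?_) m
    have := hd y
    rw [LinearMap.comp_apply, LinearMap.comp_apply, free_smul_ofFree,
      freeDegMap_ofFree _ _ _ _ _ (by omega), freeDegMap_ofFree _ _ _ _ _ (by omega)]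
    exact M.mul_smul _ _ _ _ _ _ _

theorem freeDegHom_ofFree {M : GradedMod A} (p : ℤ) {d : Y → ℤ}
    (hd : ∀ y, deg y + p = d y) (x : ∀ y, M.X (d y)) {i j : ℤ} (h : i + p = j) (y : Y)
    (h' : i - deg y + d y = j) (a : A.X (i - deg y)) :
    (freeDegHom p hd x).map h (ofFree deg y i a) = M.smul h' a (x y) :=
  freeDegMap_ofFree p hd x h y h' a

theorem freeDegHom_freeBasis {M : GradedMod A} (p : ℤ) {d : Y → ℤ}
    (hd : ∀ y, deg y + p = d y) (x : ∀ y, M.X (d y)) (y : Y) :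
    (freeDegHom p hd x).map (hd y) (freeBasis A deg y) = x y := by
  rw [freeBasis, freeDegHom_ofFree _ _ _ _ _ (by omega), M.unit_smul]

/-- The morphism out of a free module with prescribed values on the basis. -/
noncomputable def freeHom {M : GradedMod A} (x : ∀ y, M.X (deg y)) :
    GradedModHom (A.free Y deg) M :=
  (freeDegHom 0 (fun y => add_zero (deg y)) x).toHom

theorem freeHom_freeBasis {M : GradedMod A} (x : ∀ y, M.X (deg y)) (y : Y) :
    (freeHom x).map (deg y) (freeBasis A deg y) = x y :=
  freeDegHom_freeBasis 0 (fun y => add_zero (deg y)) x y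

theorem free_degHom_ext {M : GradedMod A} {p : ℤ} (f g : DegHom p (A.free Y deg) M)
    {d : Y → ℤ} (hd : ∀ y, deg y + p = d y)
    (H : ∀ y, f.map (hd y) (freeBasis A deg y) = g.map (hd y) (freeBasis A deg y))
    {i j : ℤ} (h : i + p = j) (x : (A.free Y deg).X i) : f.map h x = g.map h x := by
  refine LinearMap.congr_fun (free_linearMap_ext fun y a => ?_) x
  have h' : i - deg y + d y = j := by have := hd y; omega
  rw [ofFree_eq, f.map_smul _ (hd y) _ h', g.map_smul _ (hd y) _ h', H]

theorem free_hom_ext {M : GradedMod A} (f g : GradedModHom (A.free Y deg) M)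
    (H : ∀ y, f.map _ (freeBasis A deg y) = g.map _ (freeBasis A deg y))
    {i : ℤ} (x : (A.free Y deg).X i) : f.map i x = g.map i x := by
  refine LinearMap.congr_fun (free_linearMap_ext fun y a => ?_) x
  rw [ofFree_eq, f.map_smul, g.map_smul, H]

theorem free_isProjective (A : GradedAlg.{u} k) (Y : Type u) (deg : Y → ℤ) :
    (A.free Y deg).IsProjective := by
  intro M N g f hg
  choose x hx using fun y => hg _ (f.map _ (freeBasis A deg y))
  refine ⟨freeHom x, fun i z => ?_⟩
  exact free_hom_ext (g.comp (freeHom x)) f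
    (fun y => by rw [GradedModHom.comp_map, freeHom_freeBasis, hx]) z

end GradedAlg

/-! ### Free and projective resolutions, projective dimension -/

namespace GradedMod

/-- The free module on all homogeneous elements of `M`. -/
noncomputable abbrev cover (M : GradedMod A) : GradedMod A :=
  A.free (Σ i : ℤ, M.X i) Sigma.fst

/-- The canonical morphism from the free module on all homogeneous elements. -/
noncomputable def coverMap (M : GradedMod A) : GradedModHom M.cover M :=
  GradedAlg.freeHom fun y => y.2

theorem coverMap_surjective (M : GradedMod A) (i : ℤ) : Surjective (M.coverMap.map i) :=
  fun x => ⟨GradedAlg.freeBasis A Sigma.fst ⟨i, x⟩, GradedAlg.freeHom_freeBasis _ _⟩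

/-- The first syzygy with respect to the canonical free cover. -/
noncomputable abbrev syz (M : GradedMod A) : GradedMod A := M.coverMap.ker

/-- All homogeneous components vanish. -/
def IsZero (M : GradedMod A) : Prop := ∀ i, Subsingleton (M.X i)

/-- `M` has a free resolution with at most `r` terms. -/
def HasFreeRes : ℕ → GradedMod A → Prop
  | 0, M => M.IsZero
  | r + 1, M => ∃ (Y : Type u) (deg : Y → ℤ) (φ : GradedModHom (A.free Y deg) M),
      (∀ i, Surjective (φ.map i)) ∧ HasFreeRes r φ.ker

/-- `M` has a projective resolution with at most `r` terms. -/
def HasProjRes : ℕ → GradedMod A → Prop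
  | 0, M => M.IsZero
  | r + 1, M => ∃ (P : GradedMod A) (φ : GradedModHom P M), P.IsProjective ∧
      (∀ i, Surjective (φ.map i)) ∧ HasProjRes r φ.ker

theorem HasFreeRes.hasProjRes : ∀ {r : ℕ} {M : GradedMod A}, M.HasFreeRes r → M.HasProjRes r
  | 0, _, h => h
  | _ + 1, _, ⟨Y, deg, φ, hφ, h⟩ => ⟨_, φ, A.free_isProjective Y deg, hφ, h.hasProjRes⟩

theorem IsProjective.of_section {M P : GradedMod A} (hP : P.IsProjective)
    (φ : GradedModHom P M) (s : GradedModHom M P) (hs : ∀ i x, φ.map i (s.map i x) = x) :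
    M.IsProjective := by
  intro X Y g f hg
  obtain ⟨h, hh⟩ := hP X Y g (f.comp φ) hg
  exact ⟨h.comp s, fun i x => by simp [hh, hs]⟩

theorem IsProjective.hasProjRes {M : GradedMod A} (hM : M.IsProjective) : M.HasProjRes 1 :=
  ⟨M, GradedModHom.id M, hM, fun _ x => ⟨x, rfl⟩, fun _ =>
    ⟨fun x y => Subtype.ext ((show x.1 = 0 from x.2).trans (show y.1 = 0 from y.2).symm)⟩⟩

/-- The zero module. -/
def zero (A : GradedAlg.{u} k) : GradedMod A where
  X := fun _ => PUnit
  smul := fun _ => 0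
  one_smul := fun _ => rfl
  mul_smul := fun _ _ _ _ _ _ _ => rfl

theorem IsZero.isProjective {M : GradedMod A} (h : M.IsZero) : M.IsProjective := by
  intro X Y g f _
  refine ⟨GradedModHom.zero _ _, fun i x => ?_⟩
  have := h i
  rw [Subsingleton.elim x 0]
  simp

end GradedMod

section Resolution

open GradedMod

/-- Splicing a projective resolution of a kernel. -/
def ProjResolution.cons {M P : GradedMod A} (hP : P.IsProjective) (φ : GradedModHom P M)
    (hφ : ∀ i, Surjective (φ.map i)) {n : ℕ} (S : ProjResolution φ.ker n) :
    ProjResolution M (n + 1) where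
  P := fun p => Nat.casesOn p P S.P
  proj := fun p => match p with
    | 0 => hP
    | p + 1 => S.proj p
  δ := fun p => match p with
    | 0 => φ.kerι.comp S.ε
    | p + 1 => S.δ p
  ε := φ
  surj := hφ
  exact_zero := by
    intro i x
    constructor
    · intro hx
      obtain ⟨y, rfl⟩ := φ.exists_kerι_eq hx
      obtain ⟨z, rfl⟩ := S.surj i y
      exact ⟨z, rfl⟩
    · rintro ⟨z, rfl⟩
      exact φ.map_kerι _
  exact_succ := fun p i => match p with
    | 0 => by
      intro x
      refine Iff.trans ?_ (S.exact_zero i x)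
      exact (map_eq_zero_iff (φ.kerι.map i) (φ.kerSub.incl_injective i))
    | p + 1 => S.exact_succ p i
  bounded := fun p hp i => match p with
    | 0 => by omega
    | p + 1 => S.bounded p (by omega) i

theorem GradedMod.HasProjRes.nonempty : ∀ {n : ℕ} {M : GradedMod A}, M.HasProjRes (n + 1) →
    Nonempty (ProjResolution M n)
  | 0, M, ⟨P, φ, hP, hφ, h⟩ => ⟨{
      P := fun p => Nat.casesOn p P fun _ => zero A
      proj := fun p => match p with
        | 0 => hP
        | p + 1 => IsZero.isProjective fun _ => inferInstanceAs (Subsingleton PUnit)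
      δ := fun p => GradedModHom.zero _ _
      ε := φ
      surj := hφ
      exact_zero := by
        intro i x
        have := h i
        constructor
        · intro hx
          obtain ⟨y, rfl⟩ := φ.exists_kerι_eq hx
          rw [Subsingleton.elim y 0, map_zero]
          exact ⟨0, rfl⟩
        · rintro ⟨y, rfl⟩
          exact map_zero _
      exact_succ := fun p i x => ⟨fun _ => ⟨PUnit.unit, rfl⟩, fun _ => rfl⟩
      bounded := fun p hp i => match p with
        | 0 => by omega
        | p + 1 => inferInstanceAs (Subsingleton PUnit) }⟩
  | n + 1, M, ⟨P, φ, hP, hφ, h⟩ => h.nonempty.elim fun S => ⟨S.cons hP φ hφ⟩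

/-- Induction on the number of terms: by exactness `P 1` maps onto the kernel of `ε`, so the tail of
the complex resolves that kernel. The data are unbundled because the induction ends at `r = 0`,
while a `ProjResolution` of length `n` always allows `n + 1` terms. -/
theorem hasProjRes_of_exact : ∀ (r : ℕ) (M : GradedMod A) (P : ℕ → GradedMod A)
    (_ : ∀ p, (P p).IsProjective) (δ : ∀ p, GradedModHom (P (p + 1)) (P p))
    (ε : GradedModHom (P 0) M) (_ : ∀ i, Surjective (ε.map i))
    (_ : ∀ i, Exact ((δ 0).map i) (ε.map i))
    (_ : ∀ p i, Exact ((δ (p + 1)).map i) ((δ p).map i))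
    (_ : ∀ p, r ≤ p → (P p).IsZero), M.HasProjRes r
  | 0, M, P, _, δ, ε, hε, _, _, hb => fun i => by
      have := hb 0 le_rfl i
      exact (hε i).subsingleton
  | r + 1, M, P, hP, δ, ε, hε, h0, hs, hb => by
      have hk : ∀ i x, (δ 0).map i x ∈ ε.kerSub.X i := fun i x => (h0 i _).2 ⟨x, rfl⟩
      refine ⟨P 0, ε, hP 0, hε, hasProjRes_of_exact r _ (fun p => P (p + 1)) (fun p => hP _)
        (fun p => δ (p + 1)) (ε.kerSub.codRestrict (δ 0) hk) ?_ ?_ (fun p i => hs (p + 1) i)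
        fun p hp => hb _ (by omega)⟩
      · rintro i ⟨y, hy⟩
        obtain ⟨z, hz⟩ := (h0 i y).1 hy
        exact ⟨z, Subtype.ext hz⟩
      · intro i x
        refine Iff.trans ?_ (hs 0 i x)
        exact (map_eq_zero_iff (ε.kerι.map i) (ε.kerSub.incl_injective i)).symm

theorem GradedMod.projDim_le_iff (M : GradedMod A) (n : ℕ) :
    M.projDim ≤ n ↔ M.HasProjRes (n + 1) := by
  constructor
  · intro h
    -- A strict bound on the infimum yields an actual resolution.
    have h1 : M.projDim < (n + 1 : ℕ) := h.trans_lt (by exact_mod_cast Nat.lt_succ_self n)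
    simp only [projDim, iInf_lt_iff] at h1
    obtain ⟨m, ⟨S⟩, hm⟩ := h1
    have hm : m < n + 1 := by exact_mod_cast hm
    exact hasProjRes_of_exact _ M S.P S.proj S.δ S.ε S.surj S.exact_zero S.exact_succ
      fun p hp i => S.bounded p (by omega) i
  · intro h
    exact iInf₂_le_of_le n h.nonempty le_rfl

theorem GradedAlg.glDim_le_iff (A : GradedAlg.{u} k) (n : ℕ) :
    A.glDim ≤ n ↔ ∀ M : GradedMod A, M.HasProjRes (n + 1) := by
  simp only [glDim, iSup_le_iff, GradedMod.projDim_le_iff]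

end Resolution

/-! ### Graded duality between `A^op`-modules and `A`-modules -/

namespace GradedMod

/-- The action of `A` on a module over the opposite algebra. -/
def opSmul (S : GradedMod A.op) {i j l : ℤ} (h : i + j = l) : A.X i →ₗ[k] S.X j →ₗ[k] S.X l :=
  S.smul h

theorem one_opSmul (S : GradedMod A.op) {i : ℤ} (h : 0 + i = i) (s : S.X i) :
    S.opSmul h A.one s = s := S.one_smul s

theorem opSmul_opSmul (S : GradedMod A.op) {i j l p q r : ℤ} (hp : i + j = p) (hq : i + l = q)
    (hr : j + q = r) (hr' : p + l = r) (a : A.X i) (b : A.X j) (s : S.X l) :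
    S.opSmul hr b (S.opSmul hq a s) = (i * j).negOnePow • S.opSmul hr' (A.mul hp a b) s := by
  refine (S.mul_smul (show j + i = p by omega) hr' hq hr b a s).symm.trans ?_
  rw [A.op_mul _ hp, mul_comm]
  change S.opSmul hr' ((i * j).negOnePow • A.mul hp a b) s = _
  simp only [Units.smul_def, map_zsmul, LinearMap.smul_apply]

/-- The graded dual of a module over the opposite algebra, with values in `A^0`. -/
def dual (S : GradedMod A.op) : GradedMod A where
  -- For connected `A`, the space `A^0` is a copy of `k` that lies in the universe of the modules.
  X := fun i => S.X (-i) →ₗ[k] A.X 0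
  smul := fun {i j l} h =>
    LinearMap.mk₂ k (fun a ξ =>
        -- The sign, with `l` the degree of the result, absorbs the sign `(-1)^(ij)` of the
        -- multiplication of `A^op` and makes the action associative.
        (i * l).negOnePow • (ξ ∘ₗ S.opSmul (show i + -l = -j by omega) a))
      (by intro a a' ξ; rw [map_add, LinearMap.comp_add, smul_add])
      (by intro c a ξ; rw [map_smul, LinearMap.comp_smul, smul_comm])
      (by intro a ξ ξ'; rw [LinearMap.add_comp, smul_add])
      (by intro c a ξ; rw [LinearMap.smul_comp, smul_comm])
  one_smul := by
    intro i ξ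
    refine LinearMap.ext fun s => ?_
    change (0 * i).negOnePow • ξ (S.opSmul _ A.one s) = ξ s
    rw [S.one_opSmul, zero_mul, Int.negOnePow_zero, _root_.one_smul]
  mul_smul := by
    intro i j l p q r hp hr hq hr' a b ξ
    refine LinearMap.ext fun s => ?_
    change (p * r).negOnePow • ξ (S.opSmul _ (A.mul hp a b) s) =
      (i * r).negOnePow • ((j * q).negOnePow • ξ (S.opSmul _ b (S.opSmul _ a s)))
    rw [S.opSmul_opSmul hp _ _ (show p + -r = -l by omega)]
    simp only [Units.smul_def, map_zsmul, smul_smul]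
    rw [← Units.val_mul, ← Units.val_mul, ← Int.negOnePow_add, ← Int.negOnePow_add]
    congr 2
    subst hp hq hr
    rw [Int.negOnePow_eq_iff]
    exact ⟨0, by ring⟩

/-- The evaluation of an element of the graded dual. -/
def dualEval (S : GradedMod A.op) (i : ℤ) : S.dual.X i →ₗ[k] S.X (-i) →ₗ[k] A.X 0 :=
  LinearMap.id

theorem dual_ext (S : GradedMod A.op) {i : ℤ} {ξ η : S.dual.X i}
    (h : ∀ s, S.dualEval i ξ s = S.dualEval i η s) : ξ = η :=
  LinearMap.ext h

theorem dualEval_smul (S : GradedMod A.op) {i j l : ℤ} (h : i + j = l) (h' : i + -l = -j)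
    (a : A.X i) (ξ : S.dual.X j) (s : S.X (-l)) :
    S.dualEval l (S.dual.smul h a ξ) s =
      (i * l).negOnePow • S.dualEval j ξ (S.opSmul h' a s) := rfl

end GradedMod

namespace GradedModHom

open GradedMod

variable {S T : GradedMod A.op}

theorem map_opSmul (f : GradedModHom S T) {i j l : ℤ} (h : i + j = l) (a : A.X i) (s : S.X j) :
    f.map l (S.opSmul h a s) = T.opSmul h a (f.map j s) := f.map_smul h a s

/-- The transpose of a morphism. -/
def dualMap (f : GradedModHom S T) : GradedModHom T.dual S.dual where
  map := fun i => LinearMap.lcomp k (A.X 0) (f.map (-i))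
  map_smul := by
    intro i j l h a ξ
    refine S.dual_ext fun s => ?_
    rw [S.dualEval_smul h (by omega)]
    change T.dualEval l (T.dual.smul h a ξ) (f.map (-l) s) = 
      (i * l).negOnePow • T.dualEval j ξ (f.map (-j) _)
    rw [T.dualEval_smul h (by omega), f.map_opSmul]

theorem dualEval_dualMap (f : GradedModHom S T) {i : ℤ} (ξ : T.dual.X i) (s : S.X (-i)) :
    S.dualEval i (f.dualMap.map i ξ) s = T.dualEval i ξ (f.map (-i) s) := rfl

theorem dualMap_injective (f : GradedModHom S T) (hf : ∀ i, Surjective (f.map i)) (i : ℤ) :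
    Injective (f.dualMap.map i) := by
  intro ξ η h
  refine T.dual_ext fun t => ?_
  obtain ⟨s, rfl⟩ := hf _ t
  rw [← dualEval_dualMap, h, dualEval_dualMap]

/-- Functionals extend along an injection because it splits over the field `k`. -/
theorem dualMap_surjective (f : GradedModHom S T) (hf : ∀ i, Injective (f.map i)) (i : ℤ) :
    Surjective (f.dualMap.map i) := by
  intro ξ
  obtain ⟨g, hg⟩ := (f.map (-i)).exists_leftInverse_of_injective (LinearMap.ker_eq_bot.2 (hf _))
  refine ⟨(S.dualEval i ξ ∘ₗ g : T.X (-i) →ₗ[k] A.X 0), S.dual_ext fun s => ?_⟩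
  change S.dualEval i ξ (g (f.map (-i) s)) = _
  rw [show g (f.map (-i) s) = s from LinearMap.congr_fun hg s]

/-- An element of the dual that vanishes on the kernel of a surjection comes from the target. -/
theorem exists_dualMap_eq (f : GradedModHom S T) (hf : ∀ i, Surjective (f.map i)) {i : ℤ}
    (ξ : S.dual.X i) (hξ : ∀ s, f.map (-i) s = 0 → S.dualEval i ξ s = 0) :
    ∃ η : T.dual.X i, f.dualMap.map i η = ξ := by
  obtain ⟨g, hg⟩ := (f.map (-i)).exists_rightInverse_of_surjective
    (LinearMap.range_eq_top.2 (hf _))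
  refine ⟨(S.dualEval i ξ ∘ₗ g : T.X (-i) →ₗ[k] A.X 0), S.dual_ext fun s => ?_⟩
  change S.dualEval i ξ (g (f.map (-i) s)) = _
  rw [← sub_eq_zero, ← map_sub]
  apply hξ
  rw [map_sub, sub_eq_zero]
  exact LinearMap.congr_fun hg _

end GradedModHom

namespace GradedMod

section DualFree

variable {Y : Type u} {deg : Y → ℤ}

theorem opSmul_ofFree (y : Y) {i j l : ℤ} (h : i + j = l) (h' : i + (j - deg y) = l - deg y)
    (a : A.X i) (b : A.X (j - deg y)) :
    (A.op.free Y deg).opSmul h a (GradedAlg.ofFree (A := A.op) deg y j b) =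
      (i * (j - deg y)).negOnePow •
        GradedAlg.ofFree (A := A.op) deg y l (A.mul ((add_comm _ _).trans h') b a) := by
  refine (GradedAlg.free_smul_ofFree (A := A.op) h y a b).trans ?_
  rw [A.op_mul _ ((add_comm _ _).trans h')]
  simp only [Units.smul_def]
  exact map_zsmul (GradedAlg.ofFree (A := A.op) deg y l) _ _

open Classical in
/-- The linear map to a dual of a free module described by functionals. -/
noncomputable def toDualFree {N : GradedMod A} (φ : ∀ y, N.X (-deg y) →ₗ[k] A.X 0) (i : ℤ) :
    N.X i →ₗ[k] (A.op.free Y deg).dual.X i :=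
  LinearMap.flip (DirectSum.toModule k Y (N.X i →ₗ[k] A.X 0) fun y =>
    -- Linearity forces this sign: for an element `ξ` of the dual, `(aξ)(e_y) = (-1)^(|a| deg y) ξ(a
    -- e_y)`, and here `|a| = -i - deg y`.
    ((-i - deg y) * deg y).negOnePow •
      (LinearMap.compr₂ (N.smul (show -i - deg y + i = -deg y by omega)) (φ y)))

theorem toDualFree_ofFree {N : GradedMod A} (φ : ∀ y, N.X (-deg y) →ₗ[k] A.X 0) {i : ℤ}
    (x : N.X i) (y : Y) (h : -i - deg y + i = -deg y) (a : A.X (-i - deg y)) :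
    (A.op.free Y deg).dualEval i (toDualFree φ i x) (GradedAlg.ofFree (A := A.op) deg y (-i) a) =
      ((-i - deg y) * deg y).negOnePow • φ y (N.smul h a x) := by
  classical
  exact LinearMap.congr_fun (DirectSum.toModule_lof (φ := fun y =>
    ((-i - deg y) * deg y).negOnePow •
      (LinearMap.compr₂ (N.smul (show -i - deg y + i = -deg y by omega)) (φ y))) k y a) x

theorem dual_free_ext {i : ℤ} {ξ η : (A.op.free Y deg).dual.X i}
    (h : ∀ y (a : A.X (-i - deg y)),
      (A.op.free Y deg).dualEval i ξ (GradedAlg.ofFree (A := A.op) deg y (-i) a) =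
      (A.op.free Y deg).dualEval i η (GradedAlg.ofFree (A := A.op) deg y (-i) a)) : ξ = η :=
  GradedAlg.free_linearMap_ext (A := A.op) h

/-- The morphism to a dual of a free module described by functionals. -/
noncomputable def homDualFree {N : GradedMod A} (φ : ∀ y, N.X (-deg y) →ₗ[k] A.X 0) :
    GradedModHom N (A.op.free Y deg).dual where
  map := toDualFree φ
  map_smul := by
    intro i j l h a x
    refine dual_free_ext fun y b => ?_
    rw [dualEval_smul _ h (by omega), opSmul_ofFree y _ (by omega), toDualFree_ofFree _ _ _ (by omega)]
    simp only [Units.smul_def, map_zsmul]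
    rw [toDualFree_ofFree _ _ _ (by omega),
      N.mul_smul (q := l) _ _ h (by omega)]
    simp only [Units.smul_def, smul_smul]
    rw [← Units.val_mul, ← Units.val_mul, ← Int.negOnePow_add, ← Int.negOnePow_add]
    congr 2
    subst h
    rw [Int.negOnePow_eq_iff]
    exact ⟨0, by ring⟩

/-- The dual of a free module is injective. -/
theorem exists_extend_dual_free {M N : GradedMod A}
    (ι : GradedModHom M N) (hι : ∀ i, Injective (ι.map i))
    (f : GradedModHom M (A.op.free Y deg).dual) :
    ∃ g : GradedModHom N (A.op.free Y deg).dual, ∀ i x, g.map i (ι.map i x) = f.map i x := by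
  -- A morphism to the dual of a free module is determined by evaluating its values at the basis
  -- elements. These are plain functionals, and they extend along `ι` over the field.
  have hy : ∀ y, ∃ φ : N.X (-deg y) →ₗ[k] A.X 0, ∀ x, φ (ι.map _ x) =
      (A.op.free Y deg).dualEval _ (f.map _ x)
        (GradedAlg.ofFree (A := A.op) deg y _ (A.unit (show - -deg y - deg y = 0 by omega))) := by
    intro y
    obtain ⟨r, hr⟩ := (ι.map (-deg y)).exists_leftInverse_of_injective
      (LinearMap.ker_eq_bot.2 (hι _))
    refine ⟨((A.op.free Y deg).dualEval _).flip (GradedAlg.ofFree (A := A.op) deg y _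
      (A.unit (show - -deg y - deg y = 0 by omega))) ∘ₗ f.map _ ∘ₗ r, fun x => ?_⟩
    have : r (ι.map _ x) = x := LinearMap.congr_fun hr x
    simp [this]
  choose φ hφ using hy
  refine ⟨homDualFree φ, fun i x => dual_free_ext fun y a => ?_⟩
  have h : -i - deg y + i = -deg y := by omega
  refine (toDualFree_ofFree φ _ y h a).trans ?_
  rw [← ι.map_smul, hφ, f.map_smul, dualEval_smul _ _ (by omega), opSmul_ofFree y _ (by omega),
    A.unit_mul (by omega)]
  simp only [Units.smul_def, map_zsmul, smul_smul]
  rw [← Units.val_mul, ← Units.val_mul, ← Int.negOnePow_add, ← Int.negOnePow_add,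
    Int.negOnePow_even _ ⟨0, by ring⟩, Units.val_one, _root_.one_smul]

end DualFree

/-- Every morphism from a module with a projective resolution with `r` terms to the dual of `S`
extends along any injection. -/
def DualExtends (r : ℕ) (S : GradedMod A.op) : Prop :=
  ∀ (M N : GradedMod A), M.HasProjRes r → ∀ (ι : GradedModHom M N), (∀ i, Injective (ι.map i)) →
    ∀ f : GradedModHom M S.dual, ∃ g : GradedModHom N S.dual,
      ∀ i x, g.map i (ι.map i x) = f.map i x

theorem dualExtends_zero (S : GradedMod A.op) : S.DualExtends 0 := by
  intro M N hM ι _ f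
  refine ⟨GradedModHom.zero _ _, fun i x => ?_⟩
  have := hM i
  simp [Subsingleton.elim x 0]

/-- With `Q` the free module and `K` the kernel of `φ`, the sequence `0 → S^* → Q^* → K^* → 0` is
exact, and the claim amounts to the vanishing of the obstruction in `Ext^1(M, S^*)`. Over a
projective cover `P` of `M` the lift exists. On the kernel of `P → M` it takes values in `S^*`; this
restriction extends to `P` by `hS`, and after subtracting the extension the lift descends to `M`. -/
theorem DualExtends.exists_lift {r : ℕ} {S : GradedMod A.op} (hS : S.DualExtends r)
    {Y : Type u} {deg : Y → ℤ} (φ : GradedModHom (A.op.free Y deg) S)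
    (hφ : ∀ i, Surjective (φ.map i)) {M : GradedMod A} (hM : M.HasProjRes (r + 1))
    (f : GradedModHom M φ.ker.dual) :
    ∃ g : GradedModHom M (A.op.free Y deg).dual,
      ∀ i x, φ.kerι.dualMap.map i (g.map i x) = f.map i x := by
  obtain ⟨P, π, hP, hπ, hK⟩ := hM
  have hs := φ.kerι.dualMap_surjective φ.kerSub.incl_injective
  obtain ⟨g, hg⟩ := hP _ _ φ.kerι.dualMap (f.comp π) hs
  obtain ⟨e, he⟩ := φ.dualMap.exists_lift_injective (φ.dualMap_injective hφ)
    (g.comp π.kerι) (by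
      intro i x
      apply φ.exists_dualMap_eq hφ
      intro s hs
      obtain ⟨t, rfl⟩ := φ.exists_kerι_eq hs
      rw [← GradedModHom.dualEval_dualMap, GradedModHom.comp_map, hg, GradedModHom.comp_map,
        π.map_kerι, map_zero, map_zero]
      rfl)
  obtain ⟨e', he'⟩ := hS _ _ hK π.kerι π.kerSub.incl_injective e
  obtain ⟨h, hh⟩ := π.exists_factor hπ (g.sub (φ.dualMap.comp e')) (by
    intro i x hx
    obtain ⟨y, rfl⟩ := π.exists_kerι_eq hx
    rw [GradedModHom.sub_map, GradedModHom.comp_map, he', he, GradedModHom.comp_map, sub_self])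
  refine ⟨h, fun i x => ?_⟩
  obtain ⟨x, rfl⟩ := hπ i x
  rw [hh, GradedModHom.sub_map, map_sub, hg]
  refine (sub_eq_self).2 (φ.ker.dual_ext fun s => ?_)
  rw [GradedModHom.dualEval_dualMap, GradedModHom.comp_map, GradedModHom.dualEval_dualMap,
    φ.map_kerι, map_zero, map_zero]
  rfl

/-- Dimension shifting: a morphism to the dual of the kernel lifts to the dual of the free module,
which is injective, so the lift extends. -/
theorem DualExtends.succ {r : ℕ} {S : GradedMod A.op} (hS : S.DualExtends r)
    {Y : Type u} {deg : Y → ℤ} (φ : GradedModHom (A.op.free Y deg) S)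
    (hφ : ∀ i, Surjective (φ.map i)) : φ.ker.DualExtends (r + 1) := by
  intro M N hM ι hι f
  obtain ⟨g, hg⟩ := hS.exists_lift φ hφ hM f
  obtain ⟨h, hh⟩ := exists_extend_dual_free ι hι g
  exact ⟨φ.kerι.dualMap.comp h, fun i x => by rw [GradedModHom.comp_map, hh, hg]⟩

end GradedMod

/-! ### Nakayama's lemma and minimal covers over a connected algebra -/

theorem GradedAlg.IsConnected.op (hA : A.IsConnected) : A.op.IsConnected := hA

theorem GradedAlg.IsConnected.exists_smul_unit (hA : A.IsConnected) {i : ℤ} (hi : i = 0)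
    (a : A.X i) : ∃ c : k, a = c • A.unit hi := by
  subst hi
  obtain ⟨c, hc⟩ := hA.2.2 a
  exact ⟨c, hc.symm⟩

namespace GradedMod

/-- The part of degree `i` of `A⁺ M`, where `A⁺` is the part of `A` of positive degree. -/
def augPart (M : GradedMod A) (i : ℤ) : Submodule k (M.X i) :=
  Submodule.span k {z | ∃ (p j : ℤ) (h : p + j = i) (_ : 0 < p) (a : A.X p) (m : M.X j),
    z = M.smul h a m}

theorem smul_mem_augPart (M : GradedMod A) {p j i : ℤ} (h : p + j = i) (hp : 0 < p) (a : A.X p)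
    (m : M.X j) : M.smul h a m ∈ M.augPart i :=
  Submodule.subset_span ⟨p, j, h, hp, a, m, rfl⟩

/-- All components of degree less than `b` vanish. -/
def BoundedBelow (M : GradedMod A) (b : ℤ) : Prop := ∀ i < b, Subsingleton (M.X i)

/-- Graded Nakayama lemma, by induction on the degree: an element of `A⁺M` of degree `i` is a
combination of products `a m` with `m` of smaller degree, where `N` is already everything. -/
theorem BoundedBelow.mem_of_augPart {M : GradedMod A} {b : ℤ} (hM : M.BoundedBelow b)
    (N : GradedSubmod M) (hN : ∀ i, N.X i ⊔ M.augPart i = ⊤) (i : ℤ) (x : M.X i) : x ∈ N.X i := by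
  have key : ∀ n : ℕ, ∀ i, i < b + n → ∀ x : M.X i, x ∈ N.X i := by
    intro n
    induction n with
    | zero =>
      intro i hi x
      have := hM i (by simpa using hi)
      rw [Subsingleton.elim x 0]
      exact zero_mem _
    | succ n ih =>
      intro i hi x
      have hle : M.augPart i ≤ N.X i := by
        refine Submodule.span_le.2 ?_
        rintro _ ⟨p, j, h, hp, a, m, rfl⟩
        exact N.smul_mem h a m (ih j (by push_cast at hi; omega) m)
      have := hN i
      rw [sup_eq_left.2 hle] at this
      rw [this]
      trivial
  exact key (i - b + 1).toNat i (by omega) x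

theorem BoundedBelow.isZero {M : GradedMod A} {b : ℤ} (hM : M.BoundedBelow b)
    (h : ∀ i, M.augPart i = ⊤) : M.IsZero := by
  intro i
  have := hM.mem_of_augPart ⟨fun _ => ⊥, by
    intro i j l h a m hm
    rw [Submodule.mem_bot] at hm ⊢
    rw [hm, map_zero]⟩ (fun i => by rw [h i, sup_top_eq]) i
  exact subsingleton_of_forall_eq 0 this

theorem BoundedBelow.of_injective {M N : GradedMod A} {b : ℤ} (hN : N.BoundedBelow b)
    (f : GradedModHom M N) (hf : ∀ i, Injective (f.map i)) : M.BoundedBelow b := fun i hi =>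
  have := hN i hi
  (hf i).subsingleton

theorem BoundedBelow.of_surjective {M N : GradedMod A} {b : ℤ} (hM : M.BoundedBelow b)
    (f : GradedModHom M N) (hf : ∀ i, Surjective (f.map i)) : N.BoundedBelow b := fun i hi =>
  have := hM i hi
  (hf i).subsingleton

/-- The image of a morphism. -/
def _root_.GradedModHom.rangeSub {M N : GradedMod A} (f : GradedModHom M N) : GradedSubmod N where
  X := fun i => LinearMap.range (f.map i)
  smul_mem := by
    rintro i j l h a _ ⟨m, rfl⟩
    exact ⟨M.smul h a m, f.map_smul h a m⟩

theorem _root_.GradedModHom.map_mem_augPart {M N : GradedMod A} (f : GradedModHom M N) {i : ℤ}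
    {x : M.X i} (hx : x ∈ M.augPart i) : f.map i x ∈ N.augPart i := by
  have : M.augPart i ≤ (N.augPart i).comap (f.map i) := by
    refine Submodule.span_le.2 ?_
    rintro _ ⟨p, j, h, hp, a, m, rfl⟩
    simp only [Submodule.comap_coe, Set.mem_preimage, SetLike.mem_coe]
    rw [f.map_smul h]
    exact N.smul_mem_augPart h hp a _
  exact this hx

/-- A bounded below module over a connected algebra has a minimal free cover. -/
theorem BoundedBelow.exists_minimal_cover (hA : A.IsConnected) {M : GradedMod A} {b : ℤ}
    (hM : M.BoundedBelow b) :
    ∃ (Y : Type u) (deg : Y → ℤ) (φ : GradedModHom (A.free Y deg) M),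
      (∀ i, Surjective (φ.map i)) ∧ (A.free Y deg).BoundedBelow b ∧
      ∀ i x, φ.map i x = 0 → x ∈ (A.free Y deg).augPart i := by
  let B := fun i => Module.Basis.ofVectorSpace k (M.X i ⧸ M.augPart i)
  let Y := Σ i : ℤ, Module.Basis.ofVectorSpaceIndex k (M.X i ⧸ M.augPart i)
  choose s hs using fun y : Y => Submodule.mkQ_surjective (M.augPart y.1) (B y.1 y.2)
  let deg : Y → ℤ := Sigma.fst
  let φ : GradedModHom (A.free Y deg) M := GradedAlg.freeHom s
  have hφ : ∀ y, φ.map _ (GradedAlg.freeBasis A deg y) = s y := GradedAlg.freeHom_freeBasis s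
  -- The `k`-linear map `σ` sends the chosen basis of `M / A⁺M` to the free generators. It is a
  -- section of the map to `M / A⁺M`, which gives surjectivity of `φ` by Nakayama.
  let σ : ∀ i, (M.X i ⧸ M.augPart i) →ₗ[k] (A.free Y deg).X i :=
    fun i => (B i).constr k fun y => GradedAlg.freeBasis A deg ⟨i, y⟩
  have hσ : ∀ i y, σ i (B i y) = GradedAlg.freeBasis A deg ⟨i, y⟩ := fun i y =>
    (B i).constr_basis k _ y
  have hφσ : ∀ i, (M.augPart i).mkQ ∘ₗ φ.map i ∘ₗ σ i = LinearMap.id := by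
    intro i
    refine (B i).ext fun y => ?_
    simp only [LinearMap.comp_apply, hσ, LinearMap.id_apply]
    rw [← hs ⟨i, y⟩]
    exact congrArg _ (hφ ⟨i, y⟩)
  refine ⟨Y, deg, φ, ?_, ?_, ?_⟩
  · intro i x
    refine hM.mem_of_augPart φ.rangeSub (fun i => ?_) i x
    refine eq_top_iff.2 fun x _ => ?_
    have h1 := LinearMap.congr_fun (hφσ i) ((M.augPart i).mkQ x)
    rw [LinearMap.comp_apply, LinearMap.id_apply, eq_comm, ← sub_eq_zero, ← map_sub,
      Submodule.mkQ_apply, Submodule.Quotient.mk_eq_zero] at h1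
    exact Submodule.mem_sup.2 ⟨_, ⟨_, rfl⟩, _, h1, add_sub_cancel _ _⟩
  · intro i hi
    have : LinearMap.id (R := k) (M := (A.free Y deg).X i) = 0 := by
      refine GradedAlg.free_linearMap_ext fun y a => ?_
      -- A generator of degree below `b` would be a nonzero basis vector of a zero space.
      have hy : b ≤ y.1 := by
        by_contra hlt
        have h1 := hM y.1 (not_le.1 hlt)
        have h2 : Subsingleton (M.X y.1 ⧸ M.augPart y.1) :=
          (Submodule.mkQ_surjective _).subsingleton
        exact (B y.1).ne_zero y.2 (Subsingleton.elim _ _)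
      have := hA.1 (i - deg y) (by change i - y.1 < 0; omega)
      rw [Subsingleton.elim a 0, map_zero, map_zero, map_zero]
    exact subsingleton_of_forall_eq 0 fun x => LinearMap.congr_fun this x
  · intro i x hx
    -- Modulo `A⁺` times the free module, `σ` also inverts the reduction of `φ`. The coefficient of
    -- `e_y` is zero in negative degree, a scalar in degree `0` since `A^0 = k`, and in positive
    -- degree the element already lies in `A⁺` times the free module.
    have key : ((A.free Y deg).augPart i).mkQ ∘ₗ (LinearMap.id -
        σ i ∘ₗ (M.augPart i).mkQ ∘ₗ φ.map i) = 0 := by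
      refine GradedAlg.free_linearMap_ext fun y a => ?_
      rw [LinearMap.comp_apply, LinearMap.zero_apply, Submodule.mkQ_apply,
        Submodule.Quotient.mk_eq_zero]
      simp only [LinearMap.sub_apply, LinearMap.id_apply, LinearMap.comp_apply]
      rcases lt_trichotomy i y.1 with h | h | h
      · have := hA.1 (i - deg y) (by change i - y.1 < 0; omega)
        rw [Subsingleton.elim a 0, map_zero, map_zero, map_zero, map_zero, sub_zero]
        exact zero_mem _
      · obtain ⟨j, y⟩ := y
        obtain rfl : i = j := h
        obtain ⟨c, rfl⟩ := hA.exists_smul_unit (sub_self i) a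
        have h1 : GradedAlg.ofFree deg ⟨i, y⟩ i (c • A.unit (sub_self i)) =
          c • GradedAlg.freeBasis A deg ⟨i, y⟩ := map_smul _ _ _
        have h2 : φ.map i (GradedAlg.freeBasis A deg ⟨i, y⟩) = s ⟨i, y⟩ := hφ _
        have h3 : (M.augPart i).mkQ (s ⟨i, y⟩) = B i y := hs ⟨i, y⟩
        rw [h1, map_smul, map_smul, map_smul, h2, h3, hσ, sub_self]
        exact zero_mem _
      · have h1 : GradedAlg.ofFree deg y i a ∈ (A.free Y deg).augPart i := by
          rw [GradedAlg.ofFree_eq]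
          exact smul_mem_augPart _ _ (by change 0 < i - y.1; omega) _ _
        have h2 := φ.map_mem_augPart h1
        rw [(Submodule.Quotient.mk_eq_zero (M.augPart i)).2 h2 |> fun h => (show
          (M.augPart i).mkQ _ = 0 from h), map_zero, sub_zero]
        exact h1
    have := LinearMap.congr_fun key x
    simpa [hx] using this

/-- The elements annihilated by all elements of `A` of positive degree. -/
def socle (hA : A.IsConnected) (M : GradedMod A) : GradedSubmod M where
  X := fun j => 
    { carrier := {m | ∀ (p i : ℤ) (h : p + j = i), 0 < p → ∀ a : A.X p, M.smul h a m = 0}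
      add_mem' := by
        intro m m' hm hm' p i h hp a
        rw [map_add, hm p i h hp, hm' p i h hp, add_zero]
      zero_mem' := by simp
      smul_mem' := by
        intro c m hm p i h hp a
        rw [map_smul, hm p i h hp, smul_zero] }
  smul_mem := by
    intro i j l h a m hm p r h' hp b
    rw [← M.mul_smul rfl (show p + i + j = r by omega)]
    rcases lt_trichotomy i 0 with hi | hi | hi
    · have := hA.1 i hi
      rw [Subsingleton.elim a 0]
      simp
    · exact hm _ _ _ (by omega) _
    · exact hm _ _ _ (by omega) _

/-- If the kernel `K` were nonzero, Nakayama would give a nonzero functional on `K` that kills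
`A⁺K`, that is, a nonzero element of the socle of `K^*`. The inclusion of the socle lifts to the
dual of the free module `Q`, so this functional extends to one that kills `A⁺Q`. By minimality `K ⊆
A⁺Q`, so the functional is zero. -/
theorem DualExtends.ker_isZero {r : ℕ} (hA : A.IsConnected)
    (hP : ∀ M : GradedMod A, M.HasProjRes (r + 1)) {S : GradedMod A.op} (hS : S.DualExtends r)
    {Y : Type u} {deg : Y → ℤ} (φ : GradedModHom (A.op.free Y deg) S)
    (hφ : ∀ i, Surjective (φ.map i)) {b : ℤ} (hb : φ.ker.BoundedBelow b)
    (hmin : ∀ i x, φ.map i x = 0 → x ∈ (A.op.free Y deg).augPart i) : φ.ker.IsZero := by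
  refine hb.isZero fun i => ?_
  by_contra hne
  obtain ⟨ξ, hξ0, hξ⟩ := Submodule.exists_le_ker_of_lt_top _ (lt_top_iff_ne_top.2 hne)
  obtain ⟨i, rfl⟩ : ∃ j, i = -j := ⟨-i, by omega⟩
  let η : φ.ker.dual.X i := (LinearMap.toSpanSingleton k (A.X 0) A.one) ∘ₗ ξ
  have hη : η ∈ (φ.ker.dual.socle hA).X i := by
    intro p l h hp a
    refine dual_ext _ fun s => ?_
    rw [dualEval_smul _ _ (by omega)]
    have : ξ (φ.ker.opSmul (show p + -l = -i by omega) a s) = 0 :=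
      hξ (smul_mem_augPart _ _ hp _ _)
    change _ • ((ξ (φ.ker.opSmul _ a s)) • A.one) = 0
    rw [this, zero_smul, smul_zero]
  -- The bound on resolutions over `A` is applied to the socle of the dual of the kernel.
  obtain ⟨g, hg⟩ := hS.exists_lift φ hφ (hP _) (φ.ker.dual.socle hA).incl
  have hg0 : ∀ x ∈ (A.op.free Y deg).augPart (-i),
      (A.op.free Y deg).dualEval i (g.map i ⟨η, hη⟩) x = 0 := by
    intro x hx
    have : (A.op.free Y deg).augPart (-i) ≤
        LinearMap.ker ((A.op.free Y deg).dualEval i (g.map i ⟨η, hη⟩)) := by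
      refine Submodule.span_le.2 ?_
      rintro _ ⟨p, j, h, hp, a, m, rfl⟩
      obtain ⟨j, rfl⟩ : ∃ l, j = -l := ⟨-j, by omega⟩
      have h1 := g.map_smul (show p + i = j by omega) a ⟨η, hη⟩
      have h2 : (φ.ker.dual.socle hA).toMod.smul (show p + i = j by omega) a ⟨η, hη⟩ = 0 :=
        Subtype.ext (hη _ _ _ hp a)
      rw [h2, map_zero] at h1
      have h3 := dualEval_smul (A.op.free Y deg) (show p + i = j by omega) h a
        (g.map i ⟨η, hη⟩) m
      rw [← h1, map_zero, LinearMap.zero_apply, eq_comm, smul_eq_zero_iff_eq] at h3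
      exact h3
    exact this hx
  have hη0 : ∀ s, φ.ker.dualEval i η s = 0 := by
    intro s
    have h1 := hg i ⟨η, hη⟩
    change _ = η at h1
    rw [← h1, GradedModHom.dualEval_dualMap]
    exact hg0 _ (hmin _ _ (φ.map_kerι s))
  apply hξ0
  refine LinearMap.ext fun s => hA.2.1 ?_
  change ξ s • A.one = (0 : k) • A.one
  rw [zero_smul]
  exact hη0 s

/-- Here `S` plays the role of an `s`-th syzygy with `t = n - s` steps to go. Each minimal cover
raises the level of `DualExtends` by one, and at level `n` the next kernel vanishes. -/
theorem BoundedBelow.hasFreeRes_op (hA : A.IsConnected) {n : ℕ}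
    (hP : ∀ M : GradedMod A, M.HasProjRes (n + 1)) {b : ℤ} : ∀ (t s : ℕ), s + t = n →
    ∀ S : GradedMod A.op, S.BoundedBelow b → S.DualExtends s → S.HasFreeRes (t + 1) := by
  intro t
  induction t with
  | zero =>
    intro s hs S hb hS
    obtain rfl : s = n := hs
    obtain ⟨Y, deg, φ, hφ, hQ, hmin⟩ := hb.exists_minimal_cover hA.op
    exact ⟨Y, deg, φ, hφ, hS.ker_isZero hA hP φ hφ
      (hQ.of_injective _ φ.kerSub.incl_injective) hmin⟩
  | succ t ih =>
    intro s hs S hb hS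
    obtain ⟨Y, deg, φ, hφ, hQ, hmin⟩ := hb.exists_minimal_cover hA.op
    exact ⟨Y, deg, φ, hφ, ih (s + 1) (by omega) _
      (hQ.of_injective _ φ.kerSub.incl_injective) (hS.succ φ hφ)⟩

end GradedMod

/-! ### From bounded below modules to all modules -/

namespace GradedAlg

theorem free_induction {Y : Type u} {deg : Y → ℤ} {i : ℤ} {p : (A.free Y deg).X i → Prop}
    (h0 : p 0) (hof : ∀ y a, p (ofFree deg y i a)) (hadd : ∀ x x', p x → p x' → p (x + x'))
    (x : (A.free Y deg).X i) : p x := by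
  classical
  exact DirectSum.induction_on x h0 hof hadd

section Sigma

variable {Y : ℕ → Type u} (deg : ∀ m, Y m → ℤ)

/-- The degree function on a disjoint union of graded sets. -/
abbrev sigmaDeg (y : Σ m, Y m) : ℤ := deg y.1 y.2

/-- The inclusion of a summand of a free module on a disjoint union. -/
noncomputable def freeIn (m : ℕ) :
    GradedModHom (A.free (Y m) (deg m)) (A.free (Σ m, Y m) (sigmaDeg deg)) :=
  freeHom fun y => freeBasis A (sigmaDeg deg) ⟨m, y⟩

/-- The projection to a summand of a free module on a disjoint union. -/
noncomputable def freeProj (m : ℕ) :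
    GradedModHom (A.free (Σ m, Y m) (sigmaDeg deg)) (A.free (Y m) (deg m)) :=
  freeHom fun y => if h : y.1 = m then
    (by obtain ⟨j, y⟩ := y; obtain rfl : j = m := h; exact freeBasis A (deg j) y) else 0

theorem freeProj_freeBasis_self (m : ℕ) (y : Y m) :
    (freeProj deg m).map _ (freeBasis A (sigmaDeg deg) ⟨m, y⟩) = freeBasis A (deg m) y := by
  refine (freeHom_freeBasis _ _).trans ?_
  simp

theorem freeProj_freeBasis_ne {j m : ℕ} (h : j ≠ m) (y : Y j) :
    (freeProj deg m).map _ (freeBasis A (sigmaDeg deg) ⟨j, y⟩) = 0 := by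
  refine (freeHom_freeBasis _ _).trans ?_
  simp [h]

theorem freeIn_freeBasis (m : ℕ) (y : Y m) :
    (freeIn deg m).map _ (freeBasis A (deg m) y) = freeBasis A (sigmaDeg deg) ⟨m, y⟩ :=
  freeHom_freeBasis _ _

theorem freeProj_freeIn_self (m : ℕ) {i : ℤ} (x : (A.free (Y m) (deg m)).X i) :
    (freeProj deg m).map i ((freeIn deg m).map i x) = x :=
  free_hom_ext ((freeProj deg m).comp (freeIn deg m)) (GradedModHom.id _) (fun y => by
    rw [GradedModHom.comp_map, freeIn_freeBasis, freeProj_freeBasis_self]; rfl) x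

theorem freeProj_freeIn_ne {j m : ℕ} (h : j ≠ m) {i : ℤ} (x : (A.free (Y j) (deg j)).X i) :
    (freeProj deg m).map i ((freeIn deg j).map i x) = 0 :=
  free_hom_ext ((freeProj deg m).comp (freeIn deg j)) (GradedModHom.zero _ _) (fun y => by
    rw [GradedModHom.comp_map, freeIn_freeBasis, freeProj_freeBasis_ne _ h]; rfl) x

theorem freeIn_freeProj_ofFree (m : ℕ) (y : Y m) {i : ℤ} (a : A.X (i - sigmaDeg deg ⟨m, y⟩)) :
    (freeIn deg m).map i ((freeProj deg m).map i (ofFree (sigmaDeg deg) ⟨m, y⟩ i a)) =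
      ofFree (sigmaDeg deg) ⟨m, y⟩ i a := by
  rw [ofFree_eq, GradedModHom.map_smul, GradedModHom.map_smul, freeProj_freeBasis_self,
    freeIn_freeBasis]

theorem freeProj_ofFree_ne {j m : ℕ} (h : j ≠ m) (y : Y j) {i : ℤ}
    (a : A.X (i - sigmaDeg deg ⟨j, y⟩)) :
    (freeProj deg m).map i (ofFree (sigmaDeg deg) ⟨j, y⟩ i a) = 0 := by
  rw [ofFree_eq, GradedModHom.map_smul, freeProj_freeBasis_ne _ h, map_zero]

theorem exists_freeProj_eq_zero {i : ℤ} (x : (A.free (Σ m, Y m) (sigmaDeg deg)).X i) :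
    ∃ m, ∀ j, m < j → (freeProj deg j).map i x = 0 := by
  induction x using free_induction with
  | h0 => exact ⟨0, fun j _ => map_zero _⟩
  | hof y a => exact ⟨y.1, fun j hj => freeProj_ofFree_ne deg hj.ne y.2 a⟩
  | hadd x x' hx hx' =>
    obtain ⟨m, hm⟩ := hx
    obtain ⟨m', hm'⟩ := hx'
    exact ⟨max m m', fun j hj => by
      rw [map_add, hm j (by omega), hm' j (by omega), add_zero]⟩

theorem exists_sum_freeIn_freeProj {i : ℤ} (x : (A.free (Σ m, Y m) (sigmaDeg deg)).X i) :
    ∃ s : Finset ℕ, ∀ t, s ⊆ t →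
      x = ∑ m ∈ t, (freeIn deg m).map i ((freeProj deg m).map i x) := by
  induction x using free_induction with
  | h0 => exact ⟨∅, fun t _ => by simp⟩
  | hof y a =>
    refine ⟨{y.1}, fun t ht => ?_⟩
    rw [Finset.sum_eq_single_of_mem y.1 (ht (by simp))]
    · exact (freeIn_freeProj_ofFree deg y.1 y.2 a).symm
    · intro j _ hj
      rw [freeProj_ofFree_ne deg hj.symm y.2 a, map_zero]
  | hadd x x' hx hx' =>
    obtain ⟨s, hs⟩ := hx
    obtain ⟨s', hs'⟩ := hx'
    refine ⟨s ∪ s', fun t ht => ?_⟩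
    simp only [map_add, Finset.sum_add_distrib]
    rw [← hs t (Finset.union_subset_left ht), ← hs' t (Finset.union_subset_right ht)]

theorem eq_zero_of_freeProj {i : ℤ} (x : (A.free (Σ m, Y m) (sigmaDeg deg)).X i)
    (h : ∀ m, (freeProj deg m).map i x = 0) : x = 0 := by
  obtain ⟨s, hs⟩ := exists_sum_freeIn_freeProj deg x
  rw [hs s subset_rfl]
  simp [h]

end Sigma

end GradedAlg

namespace GradedSubmod

variable {M : GradedMod A}

/-- The zero submodule. -/
def bot (M : GradedMod A) : GradedSubmod M where
  X := fun _ => ⊥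
  smul_mem := by
    intro i j l h a m hm
    rw [Submodule.mem_bot] at hm ⊢
    rw [hm, map_zero]

/-- The term before the `m`-th one in a sequence of graded submodules. -/
def prev (F : ℕ → GradedSubmod M) : ℕ → GradedSubmod M
  | 0 => bot M
  | m + 1 => F m

/-- The preimage of a graded submodule. -/
def comap {P : GradedMod A} (f : GradedModHom P M) (N : GradedSubmod M) : GradedSubmod P where
  X := fun i => (N.X i).comap (f.map i)
  smul_mem := by
    intro i j l h a m hm
    rw [Submodule.mem_comap] at hm ⊢
    rw [f.map_smul h]
    exact N.smul_mem h a _ hm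

end GradedSubmod

namespace GradedMod

open GradedAlg GradedSubmod

/-- Horseshoe lemma for a countable exhaustive filtration. Free covers of the quotients lift to the
filtration steps, and their sum `Φ` covers `X`. The kernel of `Φ` is again filtered, now with the
first syzygies of the quotients as its quotients, and induction on `r` applies. -/
theorem hasFreeRes_of_filtration : ∀ (r : ℕ) (X : GradedMod A) (F : ℕ → GradedSubmod X)
    (_ : ∀ m i, (F m).X i ≤ (F (m + 1)).X i) (_ : ∀ i (x : X.X i), ∃ m, x ∈ (F m).X i)
    (C : ℕ → GradedMod A) (π : ∀ m, GradedModHom (F m).toMod (C m))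
    (_ : ∀ m i, Surjective ((π m).map i))
    (_ : ∀ m i x, (π m).map i x = 0 ↔ (F m).incl.map i x ∈ (prev F m).X i)
    (_ : ∀ m, (C m).HasFreeRes r), X.HasFreeRes r := by
  intro r
  induction r with
  | zero =>
    intro X F _ hex C π _ hπ hC i
    have key : ∀ m (x : X.X i), x ∈ (prev F m).X i → x = 0 := by
      intro m
      induction m with
      | zero => exact fun x hx => hx
      | succ m ih =>
        intro x hx
        refine ih x ((hπ m i ⟨x, hx⟩).1 ?_)
        have := hC m i
        exact Subsingleton.elim _ _
    refine subsingleton_of_forall_eq 0 fun x => ?_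
    obtain ⟨m, hm⟩ := hex i x
    exact key (m + 1) x hm
  | succ r ih =>
    intro X F hmono hex C π hπs hπ hC
    choose Y deg φ hφ hK using hC
    choose ψ hψ using fun m => free_isProjective A (Y m) (deg m) _ _ (π m) (φ m) (hπs m)
    let Φ : GradedModHom (A.free (Σ m, Y m) (sigmaDeg deg)) X :=
      freeHom fun y => (F y.1).incl.map _ ((ψ y.1).map _ (freeBasis A (deg y.1) y.2))
    have hΦ : ∀ m i x, Φ.map i ((freeIn deg m).map i x) = (F m).incl.map i ((ψ m).map i x) := by
      intro m i x
      refine free_hom_ext (Φ.comp (freeIn deg m)) ((F m).incl.comp (ψ m)) (fun y => ?_) x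
      rw [GradedModHom.comp_map, freeIn_freeBasis]
      exact freeHom_freeBasis _ _
    have hprev : ∀ m i, (prev F m).X i ≤ (F m).X i := by
      intro m i
      cases m with
      | zero => exact bot_le
      | succ m => exact hmono m i
    have hsub : ∀ m i (x : (A.free (Σ m, Y m) (sigmaDeg deg)).X i), ∀ j, m ≤ j → (∀ j, m + 1 ≤ j → (freeProj deg j).map i x = 0) →
        (freeProj deg j).map i (x - (freeIn deg m).map i ((freeProj deg m).map i x)) = 0 := by
      intro m i x j hj hx
      rw [map_sub]
      rcases hj.eq_or_lt with rfl | hj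
      · rw [freeProj_freeIn_self, sub_self]
      · rw [freeProj_freeIn_ne _ hj.ne, hx j hj, sub_zero]
    -- Together with `hsurj`: the summands of index less than `m` map exactly onto `F(m-1)`.
    have hmem : ∀ m i (x : (A.free (Σ m, Y m) (sigmaDeg deg)).X i), (∀ j, m ≤ j → (freeProj deg j).map i x = 0) →
        Φ.map i x ∈ (prev F m).X i := by
      intro m i
      induction m with
      | zero =>
        intro x hx
        rw [eq_zero_of_freeProj deg x fun m => hx m (Nat.zero_le _), map_zero]
        exact zero_mem _
      | succ m ihm =>
        intro x hx
        have h1 := ihm _ fun j hj => hsub m i x j hj hx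
        rw [map_sub, hΦ] at h1
        have h2 := add_mem (hprev m i h1) ((F m).incl_mem ((ψ m).map i ((freeProj deg m).map i x)))
        rwa [sub_add_cancel] at h2
    have hsurj : ∀ m i, ∀ x ∈ (prev F m).X i, ∃ q, (∀ j, m ≤ j → (freeProj deg j).map i q = 0) ∧
        Φ.map i q = x := by
      intro m i
      induction m with
      | zero => exact fun x hx => ⟨0, fun j _ => map_zero _, by rw [map_zero]; exact hx.symm⟩
      | succ m ihm =>
        intro x hx
        obtain ⟨x, rfl⟩ : ∃ x' : (F m).toMod.X i, (F m).incl.map i x' = x := ⟨⟨x, hx⟩, rfl⟩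
        obtain ⟨p, hp⟩ := hφ m i ((π m).map i x)
        have h0 : (π m).map i (x - (ψ m).map i p) = 0 := by
          rw [map_sub, hψ, hp, sub_self]
        obtain ⟨q, hq, hqx⟩ := ihm _ ((hπ m i _).1 h0)
        refine ⟨q + (freeIn deg m).map i p, fun j hj => ?_, ?_⟩
        · rw [map_add, hq j (by omega), freeProj_freeIn_ne _ (by omega), add_zero]
        · rw [map_add, hΦ, hqx, map_sub, sub_add_cancel]
    have hΦs : ∀ i, Surjective (Φ.map i) := by
      intro i x
      obtain ⟨m, hm⟩ := hex i x
      obtain ⟨q, _, hq⟩ := hsurj (m + 1) i x hm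
      exact ⟨q, hq⟩
    refine ⟨_, _, Φ, hΦs, ?_⟩
    -- `S m` consists of the elements of the kernel whose components of index greater than `m`
    -- vanish; its projection to the `m`-th component induces the isomorphism of `S m / S (m-1)`
    -- with the kernel of `φ m`.
    let S : ℕ → GradedSubmod Φ.ker := fun m =>
      { X := fun i => ⨅ j, ⨅ _ : m + 1 ≤ j, LinearMap.ker ((freeProj deg j).map i ∘ₗ Φ.kerι.map i)
        smul_mem := by
          intro i j l h a x hx
          simp only [Submodule.mem_iInf, LinearMap.mem_ker, LinearMap.comp_apply] at hx ⊢
          intro p hp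
          rw [GradedModHom.map_smul _ h, GradedModHom.map_smul _ h, hx p hp, map_zero] }
    have hS : ∀ m i (x : Φ.ker.X i), x ∈ (S m).X i ↔ ∀ j, m + 1 ≤ j →
        (freeProj deg j).map i (Φ.kerι.map i x) = 0 := by
      intro m i x
      simp only [S, Submodule.mem_iInf, LinearMap.mem_ker, LinearMap.comp_apply]
    have hSprev : ∀ m i (x : Φ.ker.X i), x ∈ (prev S m).X i ↔ ∀ j, m ≤ j →
        (freeProj deg j).map i (Φ.kerι.map i x) = 0 := by
      intro m i x
      cases m with
      | zero =>
        constructor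
        · intro hx j _
          rw [show x = 0 from hx, map_zero, map_zero]
        · intro hx
          exact Φ.kerSub.incl_injective i
            ((eq_zero_of_freeProj deg _ fun m => hx m (Nat.zero_le _)).trans (map_zero _).symm)
      | succ m => exact hS m i x
    have hker : ∀ m i (x : (S m).toMod.X i),
        ((freeProj deg m).comp (Φ.kerι.comp (S m).incl)).map i x ∈ (φ m).kerSub.X i := by
      intro m i x
      have h1 := hmem m i _ fun j hj => hsub m i (Φ.kerι.map i ((S m).incl.map i x)) j hj
        ((hS m i _).1 ((S m).incl_mem x))
      rw [map_sub, Φ.map_kerι, zero_sub, neg_mem_iff, hΦ, ← hπ, hψ] at h1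
      exact h1
    refine ih Φ.ker S ?_ ?_ (fun m => (φ m).ker) (fun m => (φ m).kerSub.codRestrict
      ((freeProj deg m).comp (Φ.kerι.comp (S m).incl)) (hker m)) ?_ ?_ hK
    · intro m i x hx
      rw [hS] at hx ⊢
      exact fun j hj => hx j (by omega)
    · intro i x
      obtain ⟨m, hm⟩ := exists_freeProj_eq_zero deg (Φ.kerι.map i x)
      exact ⟨m, (hS m i x).2 hm⟩
    · intro m i p
      have h1 : (F m).incl.map i ((ψ m).map i ((φ m).kerι.map i p)) ∈ (prev F m).X i := by
        rw [← hπ, hψ]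
        exact (φ m).map_kerι p
      obtain ⟨q, hq, hqx⟩ := hsurj m i _ h1
      -- An element `p` of the kernel of `φ m` becomes an element of the kernel of `Φ` after
      -- correction by components of lower index.
      have h2 : Φ.map i ((freeIn deg m).map i ((φ m).kerι.map i p) - q) = 0 := by
        rw [map_sub, hΦ, hqx, sub_self]
      obtain ⟨s, hs⟩ := Φ.exists_kerι_eq h2
      have h3 : s ∈ (S m).X i := by
        rw [hS]
        intro j hj
        rw [hs, map_sub, hq j (by omega), freeProj_freeIn_ne _ (by omega), sub_zero]
      obtain ⟨s, rfl⟩ : ∃ s' : (S m).toMod.X i, (S m).incl.map i s' = s := ⟨⟨s, h3⟩, rfl⟩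
      refine ⟨s, (φ m).kerSub.incl_injective i ?_⟩
      rw [incl_codRestrict, GradedModHom.comp_map, GradedModHom.comp_map, hs, map_sub, hq m le_rfl, freeProj_freeIn_self, sub_zero]
    · intro m i x
      rw [hSprev, ← map_eq_zero_iff _ ((φ m).kerSub.incl_injective i), incl_codRestrict,
        GradedModHom.comp_map, GradedModHom.comp_map]
      constructor
      · intro hx j hj
        rcases hj.eq_or_lt with rfl | hj
        · exact hx
        · exact (hS m i _).1 ((S m).incl_mem x) j hj
      · exact fun hx => hx m le_rfl

/-- The submodule of elements of degree at least `b`. -/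
def truncate (hA : A.IsConnected) (X : GradedMod A) (b : ℤ) : GradedSubmod X where
  X := fun i => ⨅ _ : i < b, ⊥
  smul_mem := by
    intro i j l h a m hm
    simp only [Submodule.mem_iInf, Submodule.mem_bot] at hm ⊢
    intro hl
    by_cases hi : i < 0
    · have := hA.1 i hi
      rw [Subsingleton.elim a 0]
      simp
    · rw [hm (by omega), map_zero]

theorem mem_truncate (hA : A.IsConnected) (X : GradedMod A) (b : ℤ) {i : ℤ} (x : X.X i) :
    x ∈ (X.truncate hA b).X i ↔ (i < b → x = 0) := by
  simp [truncate]

/-- Any graded module is the union of its truncations in degrees `≥ -m`. Connectedness makes these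
submodules, and the successive quotients are bounded below. -/
theorem hasFreeRes_of_boundedBelow (hA : A.IsConnected) {r : ℕ}
    (h : ∀ (b : ℤ) (X : GradedMod A), X.BoundedBelow b → X.HasFreeRes r) (X : GradedMod A) :
    X.HasFreeRes r := by
  let F : ℕ → GradedSubmod X := fun m => X.truncate hA (-m)
  refine hasFreeRes_of_filtration r X F ?_ ?_
    (fun m => ((prev F m).comap (F m).incl).quot) (fun m => ((prev F m).comap (F m).incl).proj)
    (fun m => proj_surjective _) (fun m i x => proj_eq_zero _ x) fun m => ?_
  · intro m i x hx
    rw [mem_truncate] at hx ⊢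
    exact fun hi => hx (by push_cast at hi; omega)
  · intro i x
    refine ⟨i.natAbs, ?_⟩
    rw [mem_truncate]
    intro hi
    omega
  · refine h (-m) _ (BoundedBelow.of_surjective ?_ _ (proj_surjective _))
    intro i hi
    refine subsingleton_of_forall_eq 0 fun x => Subtype.ext ?_
    exact (mem_truncate hA X _ _).1 x.2 hi

theorem hasFreeRes_op (hA : A.IsConnected) {n : ℕ}
    (hP : ∀ M : GradedMod A, M.HasProjRes (n + 1)) (S : GradedMod A.op) :
    S.HasFreeRes (n + 1) :=
  hasFreeRes_of_boundedBelow hA.op (fun _ X hX =>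
    hX.hasFreeRes_op hA hP n 0 (zero_add n) X X.dualExtends_zero) S

/-- Passing to `A^op` and back turns projective resolutions into free ones with the same number of
terms. -/
theorem hasFreeRes_of_hasProjRes (hA : A.IsConnected) {n : ℕ}
    (hP : ∀ M : GradedMod A, M.HasProjRes (n + 1)) (M : GradedMod A) :
    M.HasFreeRes (n + 1) := by
  have h := hasFreeRes_op hA.op fun S => (hasFreeRes_op hA hP S).hasProjRes
  rw [A.op_op] at h
  exact h M

end GradedMod

theorem GradedAlg.IsConnected.glDim_op_le (hA : A.IsConnected) : A.op.glDim ≤ A.glDim := by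
  induction h : A.glDim using ENat.recTopCoe with
  | top => exact le_top
  | coe n =>
    rw [GradedAlg.glDim_le_iff]
    exact fun S => (GradedMod.hasFreeRes_op hA ((A.glDim_le_iff n).1 h.le) S).hasProjRes

theorem GradedAlg.IsConnected.glDim_op (hA : A.IsConnected) : A.op.glDim = A.glDim := by
  refine le_antisymm hA.glDim_op_le ?_
  have := hA.op.glDim_op_le
  rwa [A.op_op] at this

/-! ### Lifting along filtrations with free quotients -/

section Lift

open GradedAlg

variable {X : GradedMod A} {G : ℕ → GradedSubmod X} {r : ℕ}

/-- A finite filtration of a graded module with free quotients. -/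
structure FreeFiltration (X : GradedMod A) (G : ℕ → GradedSubmod X) (r : ℕ) where
  mono : ∀ p < r, ∀ i, (G p).X i ≤ (G (p + 1)).X i
  top : ∀ i (x : X.X i), x ∈ (G r).X i
  Y : ℕ → Type u
  deg : ∀ p, Y p → ℤ
  π : ∀ p, GradedModHom (G (p + 1)).toMod (A.free (Y p) (deg p))
  surj : ∀ p < r, ∀ i, Surjective ((π p).map i)
  ker : ∀ p < r, ∀ i x, (π p).map i x = 0 ↔ (G (p + 1)).incl.map i x ∈ (G p).X i

theorem FreeFiltration.exists_section (S : FreeFiltration X G r) {p : ℕ} (hp : p < r) :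
    ∃ σ : GradedModHom (A.free (S.Y p) (S.deg p)) (G (p + 1)).toMod,
      (∀ i x, (S.π p).map i (σ.map i x) = x) ∧ ∀ i (x : (G (p + 1)).toMod.X i),
        (G (p + 1)).incl.map i (x - σ.map i ((S.π p).map i x)) ∈ (G p).X i := by
  obtain ⟨σ, hσ⟩ := free_isProjective A _ _ _ _ (S.π p) (GradedModHom.id _) (S.surj p hp)
  refine ⟨σ, hσ, fun i x => ?_⟩
  rw [← S.ker p hp, map_sub, hσ, sub_eq_zero]
  rfl

/-- Every layer splits because it is free. Starting from the identity at `p = r`, subtracting the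
split component in the layer `G(p+1)/G(p)` pushes the retraction down one step. -/
theorem FreeFiltration.exists_retraction (S : FreeFiltration X G r) : ∀ t p : ℕ, p + t = r →
    ∃ E : GradedModHom X X, (∀ i x, E.map i x ∈ (G p).X i) ∧
      ∀ i, ∀ x ∈ (G p).X i, E.map i x = x := by
  intro t
  induction t with
  | zero =>
    rintro p rfl
    exact ⟨GradedModHom.id X, fun i x => S.top i x, fun _ _ _ => rfl⟩
  | succ t ih =>
    intro p hp
    obtain ⟨E, hE, hE'⟩ := ih (p + 1) (by omega)
    have hpr : p < r := by omega
    obtain ⟨σ, hσ, hσ'⟩ := S.exists_section hpr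
    let E₁ := (G (p + 1)).codRestrict E hE
    refine ⟨E.sub ((G (p + 1)).incl.comp (σ.comp ((S.π p).comp E₁))), fun i x => ?_,
      fun i x hx => ?_⟩
    · have := hσ' i (E₁.map i x)
      rwa [map_sub] at this
    · have h1 : (S.π p).map i (E₁.map i x) = 0 := by
        rw [S.ker p hpr]
        change E.map i x ∈ _
        rwa [hE' i x (S.mono p hpr i hx)]
      simp only [GradedModHom.sub_map, GradedModHom.comp_map]
      rw [h1, map_zero, map_zero, sub_zero, hE' i x (S.mono p hpr i hx)]

/-- The quotient `X / G p`, an iterated extension of free modules, is projective, so a map that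
kills `G p` has a lift that kills `G p`. The lift is built one layer at a time. -/
theorem FreeFiltration.exists_lift (S : FreeFiltration X G r) {K P : GradedMod A}
    (ε : GradedModHom P K) (hε : ∀ i, Surjective (ε.map i)) (d : ℤ) : ∀ t p : ℕ, p + t = r →
    ∀ f : DegHom d X K, (∀ {i j} (h : i + d = j), ∀ x ∈ (G p).X i, f.map h x = 0) →
      ∃ g : DegHom d X P, (∀ {i j} (h : i + d = j) x, ε.map j (g.map h x) = f.map h x) ∧
        ∀ {i j} (h : i + d = j), ∀ x ∈ (G p).X i, g.map h x = 0 := by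
  intro t
  induction t with
  | zero =>
    rintro p rfl f hf
    exact ⟨DegHom.zero d X P, fun h x => by rw [hf h x (S.top _ x)]; simp, by simp⟩
  | succ t ih =>
    intro p hp f hf
    have hpr : p < r := by omega
    obtain ⟨E, hE, hE'⟩ := S.exists_retraction t (p + 1) (by omega)
    obtain ⟨σ, hσ, hσ'⟩ := S.exists_section hpr
    let E₁ := (G (p + 1)).codRestrict E hE
    have hE₁ : ∀ i (x : (G (p + 1)).toMod.X i), E₁.map i ((G (p + 1)).incl.map i x) = x :=
      fun i x => Subtype.ext (hE' i _ x.2)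
    let fσ : DegHom d (A.free (S.Y p) (S.deg p)) K := f.precomp ((G (p + 1)).incl.comp σ)
    choose x hx using fun y => hε _ (fσ.map (rfl : S.deg p y + d = _) (freeBasis A _ y))
    let g₀ : DegHom d (A.free (S.Y p) (S.deg p)) P := freeDegHom d (fun _ => rfl) x
    have hg₀ : ∀ {i j} (h : i + d = j) z, ε.map j (g₀.map h z) = fσ.map h z := by
      intro i j h z
      refine free_degHom_ext (DegHom.postcomp ε g₀) fσ (fun _ => rfl) (fun y => ?_) h z
      rw [DegHom.postcomp_map, freeDegHom_freeBasis, hx]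
    -- `l` lifts `f` on `G(p+1)` and kills `G p`, so the error `f - ε l` kills `G(p+1)` and the
    -- induction continues.
    let l : DegHom d X P := g₀.precomp ((S.π p).comp E₁)
    have hl : ∀ {i j} (h : i + d = j), ∀ x ∈ (G p).X i, l.map h x = 0 := by
      intro i j h x hx
      have h1 : (S.π p).map i (E₁.map i x) = 0 := by
        rw [S.ker p hpr]
        change E.map i x ∈ _
        rwa [hE' i x (S.mono p hpr i hx)]
      rw [DegHom.precomp_map, GradedModHom.comp_map, h1, map_zero]
    obtain ⟨g, hg, hg'⟩ := ih (p + 1) (by omega) (f.sub (DegHom.postcomp ε l)) (by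
      intro i j h x hx
      obtain ⟨x, rfl⟩ : ∃ x' : (G (p + 1)).toMod.X i, (G (p + 1)).incl.map i x' = x :=
        ⟨⟨x, hx⟩, rfl⟩
      have h1 := hf h _ (hσ' i x)
      rw [map_sub, map_sub] at h1
      rw [DegHom.sub_map, DegHom.postcomp_map, DegHom.precomp_map, GradedModHom.comp_map, hE₁,
        hg₀]
      exact h1)
    refine ⟨l.add g, fun h x => ?_, fun h x hx => ?_⟩
    · rw [DegHom.add_map, map_add, hg, DegHom.sub_map, DegHom.postcomp_map, add_sub_cancel]
    · rw [DegHom.add_map, hl h x hx, hg' h x (S.mono p hpr _ hx), add_zero]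

end Lift

/-! ### Projective dimension is at most cone length -/

section Stage

open GradedAlg

variable {F N : GradedMod A} {G : ℕ → GradedSubmod F} {r : ℕ}

/-- A comparison between a differential graded module `F` and a syzygy `K`. -/
structure SyzygyComparison (D : DegHom 1 F F) (G : ℕ → GradedSubmod F) (m : ℕ) (p : ℤ)
    (K : GradedMod A) where
  κ : DegHom p F K
  ψ : DegHom (-p) K.cover F
  s : GradedModHom K K.cover
  κ_D : ∀ {a b c : ℤ} (h : a + 1 = b) (h' : b + p = c) x, κ.map h' (D.map h x) = 0
  κ_eq_zero : ∀ {a b : ℤ} (h : a + p = b), ∀ x ∈ (G m).X a, κ.map h x = 0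
  homotopy : ∀ {a b : ℤ} (h : a + -p = b) (h' : b + p = a) x,
    K.coverMap.map a x - κ.map h' (ψ.map h x) =
      K.coverMap.map a (s.map a (K.coverMap.map a x))
  exact : ∀ {a b c : ℤ} (h : a + -p = b) (h' : c + 1 = b) x, K.coverMap.map a x = 0 →
    ∃ y, D.map h' y = ψ.map h x

variable {D : DegHom 1 F F}

/-- The map `1 - qψ - s ∘ coverMap` takes values in the syzygy; this is what the relation `homotopy`
expresses once `κ` is lifted to `q`. -/
theorem SyzygyComparison.exists_lift {m : ℕ} {p : ℤ} {K : GradedMod A}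
    (T : SyzygyComparison D G m p K) (S : FreeFiltration F G r) (hm : m ≤ r) :
    ∃ (q : DegHom p F K.cover) (ρ : GradedModHom K.cover K.syz),
      (∀ {i j} (h : i + p = j) x, K.coverMap.map j (q.map h x) = T.κ.map h x) ∧
      (∀ {i j} (h : i + p = j), ∀ x ∈ (G m).X i, q.map h x = 0) ∧
      ∀ {a b} (h : a + -p = b) (h' : b + p = a) x, K.coverMap.kerι.map a (ρ.map a x) =
        x - q.map h' (T.ψ.map h x) - T.s.map a (K.coverMap.map a x) := by
  obtain ⟨q, hq, hq0⟩ := S.exists_lift K.coverMap K.coverMap_surjective p (r - m) m (by omega)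
    T.κ T.κ_eq_zero
  let ρ : GradedModHom K.cover K.cover := ((GradedModHom.id _).sub
    (q.comp T.ψ (neg_add_cancel p)).toHom).sub (T.s.comp K.coverMap)
  have hρ : ∀ {a b} (h : a + -p = b) (h' : b + p = a) x, ρ.map a x =
      x - q.map h' (T.ψ.map h x) - T.s.map a (K.coverMap.map a x) := by
    intro a b h h' x
    rw [← q.comp_map T.ψ (neg_add_cancel p) (add_zero a) h h']
    rfl
  refine ⟨q, K.coverMap.kerSub.codRestrict ρ ?_, hq, hq0, hρ⟩
  intro a x
  change K.coverMap.map a _ = 0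
  rw [hρ rfl (by omega), map_sub, map_sub, hq, T.homotopy, sub_self]

/-- At the last layer the image of `D` lies in `G m`, where `q` vanishes. On the syzygy `ψ` takes
values in the image of `D`, so `ρ` retracts the cover onto the syzygy and `K` is a summand of a free
module. -/
theorem SyzygyComparison.isProjective {m : ℕ} {p : ℤ} {K : GradedMod A}
    (T : SyzygyComparison D G m p K) (S : FreeFiltration F G r) (hm : m + 1 = r)
    (hD : ∀ {a b} (h : a + 1 = b) x, D.map h x ∈ (G m).X b) :
    K.IsProjective := by
  obtain ⟨q, ρ, hq, hq0, hρ⟩ := T.exists_lift S (by omega)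
  have hρι : ∀ a (z : K.syz.X a), ρ.map a (K.coverMap.kerι.map a z) = z := by
    intro a z
    apply K.coverMap.kerSub.incl_injective a
    rw [hρ rfl (by omega), K.coverMap.map_kerι, map_zero, sub_zero]
    obtain ⟨y, hy⟩ := T.exact (rfl : a + -p = a + -p) (show a + -p - 1 + 1 = _ by omega) _
      (K.coverMap.map_kerι z)
    rw [← hy, hq0 _ _ (hD _ _), sub_zero]
  obtain ⟨s, hs⟩ := K.coverMap.exists_factor K.coverMap_surjective
    ((GradedModHom.id _).sub (K.coverMap.kerι.comp ρ)) (by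
      intro i x hx
      obtain ⟨y, rfl⟩ := K.coverMap.exists_kerι_eq hx
      rw [GradedModHom.sub_map, GradedModHom.comp_map, hρι]
      exact sub_self _)
  refine (free_isProjective A _ _).of_section K.coverMap s fun i x => ?_
  obtain ⟨x, rfl⟩ := K.coverMap_surjective i x
  rw [hs, GradedModHom.sub_map, map_sub, GradedModHom.comp_map, K.coverMap.map_kerι, sub_zero]
  rfl

/-- The new `κ` is `qD`: it lands in the syzygy because `κD = 0`, and it kills `G(m+1)` because `D`
maps `G(m+1)` into `G m`. The new `ψ` is a `D`-preimage of the old one on the syzygy. Thus `κψ`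
becomes the old `qψ`, and `ρ`, which is `1 - qψ` on the syzygy, supplies the new `s`. -/
theorem SyzygyComparison.succ {m : ℕ} {p : ℤ} {K : GradedMod A}
    (T : SyzygyComparison D G m p K) (S : FreeFiltration F G r) (hm : m < r)
    (hD : ∀ {a b} (h : a + 1 = b), ∀ x ∈ (G (m + 1)).X a, D.map h x ∈ (G m).X b)
    (hDD : ∀ {a b c} (h : a + 1 = b) (h' : b + 1 = c) x, D.map h' (D.map h x) = 0)
    (f : GradedModHom F N)
    (hsurj : ∀ a n, ∃ x, f.map a x = n ∧ ∀ b (h : a + 1 = b), D.map h x = 0)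
    (hinj : ∀ {a b c} (h : a + 1 = b) (h' : b + 1 = c) x, D.map h' x = 0 → f.map b x = 0 →
      ∃ y, D.map h y = x) :
    Nonempty (SyzygyComparison D G (m + 1) (p + 1) K.syz) := by
  obtain ⟨q, ρ, hq, hq0, hρ⟩ := T.exists_lift S hm.le
  obtain ⟨s₁, hs₁⟩ := free_isProjective A _ _ _ _ K.syz.coverMap ρ K.syz.coverMap_surjective
  have hy : ∀ y : Σ i, K.syz.X i, ∃ z : F.X (y.1 + -(p + 1)),
      (∀ b (h' : y.1 + -(p + 1) + 1 = b) (h : y.1 + -p = b),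
        D.map h' z = T.ψ.map h (K.coverMap.kerι.map _ y.2)) ∧ f.map _ z = 0 := by
    rintro ⟨a, y⟩
    obtain ⟨z, hz⟩ := T.exact (rfl : a + -p = a + -p) (show a + -(p + 1) + 1 = a + -p by omega)
      (K.coverMap.kerι.map _ y) (K.coverMap.map_kerι y)
    obtain ⟨w, hw, hDw⟩ := hsurj _ (f.map _ z)
    -- Subtracting a cocycle with the same image in `N` leaves `D z` unchanged and makes `f z = 0`,
    -- so that `hinj` proves exactness at the next stage.
    refine ⟨z - w, ?_, by rw [map_sub, hw, sub_self]⟩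
    rintro b h' rfl
    rw [map_sub, hDw, sub_zero, hz]
  choose z hz hfz using hy
  let ψ : DegHom (-(p + 1)) K.syz.cover F := freeDegHom (-(p + 1)) (fun _ => rfl) z
  have hDψ : ∀ {a b c} (h : a + -(p + 1) = b) (h' : b + 1 = c) (h'' : a + -p = c) x,
      D.map h' (ψ.map h x) =
        T.ψ.map h'' (K.coverMap.kerι.map a (K.syz.coverMap.map a x)) := by
    intro a b c h h' h'' x
    rw [← D.comp_map ψ (show -(p + 1) + 1 = -p by omega) h'' h h']
    refine free_degHom_ext _ (T.ψ.precomp (K.coverMap.kerι.comp K.syz.coverMap))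
      (fun _ => rfl) (fun y => ?_) h'' x
    rw [D.comp_map ψ _ _ rfl (by omega), freeDegHom_freeBasis, hz _ _ _ rfl,
      DegHom.precomp_map, GradedModHom.comp_map]
    congr 2
    exact (freeHom_freeBasis _ _).symm
  have hfψ : ∀ {a b} (h : a + -(p + 1) = b) x, f.map b (ψ.map h x) = 0 := by
    intro a b h x
    refine free_degHom_ext (DegHom.postcomp f ψ) (DegHom.zero _ _ _) (fun _ => rfl)
      (fun y => ?_) h x
    rw [DegHom.postcomp_map, freeDegHom_freeBasis, hfz]
    rfl
  have hqD : ∀ {i j} (h : i + (p + 1) = j) x,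
      (q.comp D (add_comm 1 p)).map h x ∈ K.coverMap.kerSub.X j := by
    intro i j h x
    change K.coverMap.map j _ = 0
    rw [q.comp_map D _ h rfl (by omega), hq, T.κ_D]
  refine ⟨{ κ := (q.comp D (add_comm 1 p)).codRestrict K.coverMap.kerSub hqD
            ψ := ψ
            s := s₁.comp K.coverMap.kerι
            κ_D := ?_
            κ_eq_zero := ?_
            homotopy := ?_
            exact := ?_ }⟩
  · intro a b c h h' x
    apply K.coverMap.kerSub.incl_injective c
    rw [DegHom.incl_codRestrict, q.comp_map D _ h' rfl (by omega), hDD, map_zero, map_zero]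
  · intro a b h x hx
    apply K.coverMap.kerSub.incl_injective b
    rw [DegHom.incl_codRestrict, q.comp_map D _ h rfl (by omega), map_zero]
    exact hq0 _ _ (hD _ _ hx)
  · intro a b h h' x
    rw [GradedModHom.comp_map, hs₁]
    apply K.coverMap.kerSub.incl_injective a
    rw [map_sub, DegHom.incl_codRestrict, q.comp_map D _ h' rfl (by omega),
      hDψ h rfl (by omega), hρ (b := b + 1) (by omega) (by omega), K.coverMap.map_kerι, map_zero,
      sub_zero]
  · intro a b c h h' x hx
    exact hinj h' rfl _ (by rw [hDψ h rfl (show a + -p = b + 1 by omega), hx, map_zero, map_zero])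
      (hfψ h x)

theorem SyzygyComparison.hasProjRes (S : FreeFiltration F G r)
    (hD : ∀ m < r, ∀ {a b} (h : a + 1 = b), ∀ x ∈ (G (m + 1)).X a, D.map h x ∈ (G m).X b)
    (hDD : ∀ {a b c} (h : a + 1 = b) (h' : b + 1 = c) x, D.map h' (D.map h x) = 0)
    (f : GradedModHom F N)
    (hsurj : ∀ a n, ∃ x, f.map a x = n ∧ ∀ b (h : a + 1 = b), D.map h x = 0)
    (hinj : ∀ {a b c} (h : a + 1 = b) (h' : b + 1 = c) x, D.map h' x = 0 → f.map b x = 0 →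
      ∃ y, D.map h y = x) :
    ∀ (t m : ℕ) (p : ℤ) (K : GradedMod A), m + t + 1 = r → SyzygyComparison D G m p K →
      K.HasProjRes (t + 1) := by
  intro t
  induction t with
  | zero =>
    intro m p K hm T
    exact (T.isProjective S hm fun h x => hD m (by omega) h x
      (by rw [show m + 1 = r by omega]; exact S.top _ x)).hasProjRes
  | succ t ih =>
    intro m p K hm T
    obtain ⟨T'⟩ := T.succ S (by omega) (hD m (by omega)) hDD f hsurj hinj
    exact ⟨K.cover, K.coverMap, free_isProjective A _ _, K.coverMap_surjective,
      ih (m + 1) (p + 1) K.syz (by omega) T'⟩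

/-- At the start `κ` is the quasi-isomorphism `f` itself, and `ψ` lifts the cover of `N` through the
cocycles of `F`, so `κψ` equals the cover map and `s = 0`. -/
theorem SyzygyComparison.initial (hG : ∀ i, ∀ x ∈ (G 0).X i, x = 0)
    (f : GradedModHom F N) (hfD : ∀ {a b} (h : a + 1 = b) x, f.map b (D.map h x) = 0)
    (hsurj : ∀ a n, ∃ x, f.map a x = n ∧ ∀ b (h : a + 1 = b), D.map h x = 0)
    (hinj : ∀ {a b c} (h : a + 1 = b) (h' : b + 1 = c) x, D.map h' x = 0 → f.map b x = 0 →
      ∃ y, D.map h y = x) : Nonempty (SyzygyComparison D G 0 0 N) := by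
  choose z hz hDz using fun y : Σ i, N.X i => hsurj y.1 y.2
  let ψ : DegHom (-0) N.cover F := freeDegHom (-0) (fun _ => by simp) z
  have hfψ : ∀ {a} (h : a + -0 = a) x, f.map a (ψ.map h x) = N.coverMap.map a x := by
    intro a h x
    rw [← N.coverMap.toDegHom_map h]
    refine free_degHom_ext (DegHom.postcomp f ψ) N.coverMap.toDegHom (d := Sigma.fst) (fun y => by simp)
      (fun y => ?_) h x
    rw [DegHom.postcomp_map, freeDegHom_freeBasis, hz, N.coverMap.toDegHom_map]
    exact (freeHom_freeBasis _ _).symm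
  have hDψ : ∀ {a b c} (h : a + -0 = b) (h' : b + 1 = c) x, D.map h' (ψ.map h x) = 0 := by
    intro a b c h h' x
    rw [← D.comp_map ψ (show -0 + 1 = 1 by omega) (show a + 1 = c by omega) h h']
    refine free_degHom_ext _ (DegHom.zero 1 _ _) (fun _ => rfl) (fun y => ?_) _ x
    rw [D.comp_map ψ _ _ (add_zero _) rfl, freeDegHom_freeBasis, hDz]
    rfl
  refine ⟨{ κ := f.toDegHom
            ψ := ψ
            s := GradedModHom.zero _ _
            κ_D := ?_
            κ_eq_zero := ?_
            homotopy := ?_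
            exact := ?_ }⟩
  · intro a b c h h' x
    obtain rfl : b = c := by omega
    rw [f.toDegHom_map, hfD]
  · intro a b h x hx
    rw [hG _ x hx, map_zero]
  · intro a b h h' x
    obtain rfl : b = a := by omega
    rw [f.toDegHom_map, hfψ, sub_self]
    simp
  · intro a b c h h' x hx
    obtain rfl : b = a := by omega
    exact hinj h' rfl _ (hDψ _ _ _) (by rw [hfψ, hx])

end Stage

/-! ### DG modules via the linear differential `D` -/

theorem Int.negOnePow_smul_eq_zero_iff {V : Type*} [AddCommGroup V] (i : ℤ) {x : V} :
    i.negOnePow • x = 0 ↔ x = 0 := smul_eq_zero_iff_eq _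

theorem Int.negOnePow_smul_smul {V : Type*} [AddCommGroup V] (i : ℤ) (x : V) :
    i.negOnePow • i.negOnePow • x = x := by
  rw [smul_smul, ← Int.negOnePow_add, Int.negOnePow_even _ ⟨i, rfl⟩, one_smul]

namespace DGMod

/-- The underlying graded module of a DG module over an algebra with zero differential. -/
abbrev gr (M : DGMod A.toDG) : GradedMod A := M.toGradedMod

/-- The differential of a DG module over an algebra with zero differential, with the sign that
makes it linear. -/
def D (M : DGMod A.toDG) : DegHom 1 M.gr M.gr where
  map := fun {i _} h => i.negOnePow • M.d h
  map_smul := by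
    intro i j l j' l' h hj hl h' a m
    have key := M.leibniz h rfl hj hl (show i + 1 + j = l' by omega) h' a m
    have h0 : A.toDG.d (rfl : i + 1 = i + 1) a = 0 := rfl
    rw [h0, map_zero, LinearMap.zero_apply, zero_add] at key
    change l.negOnePow • M.d hl (M.smul h a m) = M.smul h' a (j.negOnePow • M.d hj m)
    rw [key, smul_smul, ← Int.negOnePow_add, show l + i = j + (i + i) by omega,
      Int.negOnePow_add, Int.negOnePow_even (i + i) ⟨i, rfl⟩, mul_one]
    simp only [Units.smul_def, map_zsmul]

theorem D_map (M : DGMod A.toDG) {i j : ℤ} (h : i + 1 = j) (x : M.gr.X i) :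
    M.D.map h x = i.negOnePow • M.d h x := rfl

theorem d_eq (M : DGMod A.toDG) {i j : ℤ} (h : i + 1 = j) (x : M.gr.X i) :
    M.d h x = i.negOnePow • M.D.map h x := by
  rw [D_map, Int.negOnePow_smul_smul]

theorem D_D (M : DGMod A.toDG) {i j l : ℤ} (h : i + 1 = j) (h' : j + 1 = l) (x : M.gr.X i) :
    M.D.map h' (M.D.map h x) = 0 := by
  rw [D_map, D_map]
  simp only [Units.smul_def, map_zsmul, M.d_d, smul_zero]

theorem D_eq_zero_iff (M : DGMod A.toDG) {i j : ℤ} (h : i + 1 = j) (x : M.gr.X i) :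
    M.D.map h x = 0 ↔ M.d h x = 0 := by
  rw [D_map, Int.negOnePow_smul_eq_zero_iff]

/-- The DG module with a given linear differential. -/
def ofD (X : GradedMod A) (D : DegHom 1 X X)
    (hD : ∀ {i j l : ℤ} (h : i + 1 = j) (h' : j + 1 = l) x, D.map h' (D.map h x) = 0) :
    DGMod A.toDG where
  toGradedMod := X
  d := fun {i _} h => i.negOnePow • D.map h
  d_d := by
    intro i j l h h' x
    simp only [LinearMap.smul_apply, Units.smul_def, map_zsmul, hD, smul_zero]
  leibniz := by
    intro i j l i' j' l' h hi hj hl h₁ h₂ a m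
    change A.X i at a
    change l.negOnePow • D.map hl (X.smul h a m) =
      X.smul h₁ (0 : A.X i') m + i.negOnePow • X.smul h₂ a (j.negOnePow • D.map hj m)
    rw [map_zero, LinearMap.zero_apply, zero_add, D.map_smul h hj hl h₂, ← h,
      Int.negOnePow_add, mul_smul]
    simp only [Units.smul_def, map_zsmul]

theorem ofD_D (X : GradedMod A) (D : DegHom 1 X X) (hD) {i j : ℤ} (h : i + 1 = j) (x : X.X i) :
    (ofD X D hD).D.map h x = D.map h x :=
  Int.negOnePow_smul_smul _ _

/-- A graded module as a DG module with zero differential. -/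
abbrev ofGraded (X : GradedMod A) : DGMod A.toDG :=
  ofD X (DegHom.zero 1 X X) fun _ _ _ => rfl

theorem mem_cocycles_iff (M : DGMod A.toDG) {i j : ℤ} (h : i + 1 = j) (x : M.gr.X i) :
    x ∈ M.cocycles i ↔ M.D.map h x = 0 := by
  subst h
  rw [D_eq_zero_iff]
  rfl

theorem mem_coboundaries_iff (M : DGMod A.toDG) {i j : ℤ} (h : j + 1 = i) (x : M.gr.X i) :
    x ∈ M.coboundaries i ↔ ∃ y, M.D.map h y = x := by
  obtain rfl : j = i - 1 := by omega
  constructor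
  · rintro ⟨y, rfl⟩
    exact ⟨(i - 1).negOnePow • y, by
      rw [D_map]
      simp only [Units.smul_def, map_zsmul]
      exact Int.negOnePow_smul_smul _ _⟩
  · rintro ⟨y, rfl⟩
    exact ⟨(i - 1).negOnePow • y, by
      rw [D_map]
      simp only [Units.smul_def, map_zsmul]⟩

end DGMod

namespace DGModHom

variable {M N : DGMod A.toDG}

theorem map_D (f : DGModHom M N) {i j : ℤ} (h : i + 1 = j) (x : M.gr.X i) :
    f.map j (M.D.map h x) = N.D.map h (f.map i x) := by
  rw [DGMod.D_map, DGMod.D_map, ← f.map_d]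
  simp only [Units.smul_def, map_zsmul]

/-- A morphism of graded modules that commutes with the linear differentials. -/
def ofD (f : GradedModHom M.gr N.gr)
    (hf : ∀ {i j : ℤ} (h : i + 1 = j) x, f.map j (M.D.map h x) = N.D.map h (f.map i x)) :
    DGModHom M N where
  toGradedModHom := f
  map_d := by
    intro i j h x
    change f.map j (M.d h x) = N.d h (f.map i x)
    rw [DGMod.d_eq, DGMod.d_eq, ← hf]
    simp only [Units.smul_def, map_zsmul]

theorem isQuasiIso_iff (f : DGModHom M N) : f.IsQuasiIso ↔
    (∀ {a b c : ℤ} (h : a + 1 = b) (h' : b + 1 = c) (x : M.gr.X b), M.D.map h' x = 0 →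
      (∃ y, N.D.map h y = f.map b x) → ∃ y, M.D.map h y = x) ∧
    (∀ {a b c : ℤ} (h : a + 1 = b) (h' : b + 1 = c) (n : N.gr.X b), N.D.map h' n = 0 →
      ∃ x, M.D.map h' x = 0 ∧ ∃ y, N.D.map h y = n - f.map b x) := by
  have key : ∀ b (x : M.cocycles b), f.cohomologyMap b (Submodule.Quotient.mk x) =
      Submodule.Quotient.mk (f.cocyclesMap b x) := fun _ _ => rfl
  constructor
  · intro hf
    constructor
    · rintro a b c h h' x hx hy
      have hx' := (M.mem_cocycles_iff h' x).2 hx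
      have h1 : f.cohomologyMap b (Submodule.Quotient.mk ⟨x, hx'⟩) = 0 := by
        rw [key, Submodule.Quotient.mk_eq_zero]
        exact (N.mem_coboundaries_iff h _).2 hy
      have h2 := (hf b).1 (h1.trans (map_zero _).symm)
      rw [Submodule.Quotient.mk_eq_zero] at h2
      exact (M.mem_coboundaries_iff h x).1 h2
    · rintro a b c h h' n hn
      have hn' := (N.mem_cocycles_iff h' n).2 hn
      obtain ⟨⟨⟨x, hx⟩⟩, h1⟩ := (hf b).2 (Submodule.Quotient.mk ⟨n, hn'⟩)
      refine ⟨x, (M.mem_cocycles_iff h' x).1 hx, (N.mem_coboundaries_iff h _).1 ?_⟩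
      have h2 := (Submodule.Quotient.eq _).1 h1.symm
      exact h2
  · rintro ⟨h1, h2⟩ b
    constructor
    · rw [injective_iff_map_eq_zero]
      rintro ⟨⟨x, hx⟩⟩ h
      have h' := (Submodule.Quotient.mk_eq_zero _).1 h
      refine (Submodule.Quotient.mk_eq_zero _).2 ((M.mem_coboundaries_iff (sub_add_cancel b 1) x).2 ?_)
      exact h1 _ rfl x ((M.mem_cocycles_iff rfl x).1 hx) ((N.mem_coboundaries_iff _ _).1 h')
    · rintro ⟨⟨n, hn⟩⟩
      obtain ⟨x, hx, hy⟩ := h2 (sub_add_cancel b 1) rfl n ((N.mem_cocycles_iff rfl n).1 hn)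
      refine ⟨Submodule.Quotient.mk ⟨x, (M.mem_cocycles_iff rfl x).2 hx⟩, ?_⟩
      refine (key _ _).trans ((Submodule.Quotient.eq _).2 ?_)
      refine (Submodule.neg_mem_iff _).1 ?_
      rw [neg_sub]
      exact (N.mem_coboundaries_iff (sub_add_cancel b 1) _).2 hy

end DGModHom

theorem GradedAlg.free_d {Y : Type u} {deg : Y → ℤ} {i j : ℤ} (h : i + 1 = j)
    (x : (A.free Y deg).X i) : (A.toDG.free Y deg).d h x = 0 := by
  refine LinearMap.congr_fun (f := (A.toDG.free Y deg).d h) (g := 0)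
    (free_linearMap_ext fun y a => ?_) x
  classical
  exact (DirectSum.lmap_lof (fun y => A.toDG.d (show i - deg y + 1 = j - deg y by omega)) y a).trans
    (map_zero _)

namespace DGSubmod

variable {M : DGMod A.toDG}

/-- The underlying graded submodule. -/
def gr (N : DGSubmod M) : GradedSubmod M.gr where
  X := N.X
  smul_mem := N.smul_mem

/-- A DG free module over `A` has zero differential, so each quotient does too, and `D` lowers the
filtration by one step. -/
theorem exists_freeFiltration {F : ℕ → DGSubmod M} {r : ℕ}
    (hmono : ∀ p i, (F p).X i ≤ (F (p + 1)).X i) (htop : F r = whole M)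
    (hq : ∀ p, QuotientIsDGFree (F p) (F (p + 1))) :
    Nonempty (FreeFiltration M.gr (fun p => (F p).gr) r) ∧
    ∀ m, ∀ {a b} (h : a + 1 = b), ∀ x ∈ (F (m + 1)).X a, M.D.map h x ∈ (F m).X b := by
  choose Y deg π hs hk using hq
  refine ⟨⟨{  mono := fun p _ => hmono p
              top := fun i x => by rw [htop]; trivial
              Y := Y
              deg := deg
              π := fun p => (π p).toGradedModHom
              surj := fun p _ => hs p
              ker := fun p _ => hk p }⟩, ?_⟩
  intro m a b h x hx
  have h1 := (π m).map_d h ⟨x, hx⟩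
  have h2 := (hk m b _).1 (h1.trans (GradedAlg.free_d h _))
  change a.negOnePow • M.d h x ∈ (F m).X b
  rw [Units.smul_def]
  exact zsmul_mem h2 _

end DGSubmod

theorem SemifreeFiltration.hasProjRes {F : DGMod A.toDG} (S : SemifreeFiltration F) {n : ℕ}
    (hS : S.HasLength n) {N : GradedMod A} (f : DGModHom F (DGMod.ofGraded N))
    (hf : f.IsQuasiIso) : N.HasProjRes (n + 1) := by
  have hprev : ∀ p i, (DGSubmod.prev S.sub p).X i ≤ (DGSubmod.prev S.sub (p + 1)).X i := by
    intro p i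
    cases p with
    | zero => exact bot_le
    | succ p => exact S.mono p i
  -- Indexing by `prev` makes the zeroth term `F(-1) = 0`, so length `n` gives `n + 1` layers.
  obtain ⟨⟨T⟩, hT⟩ := DGSubmod.exists_freeFiltration (r := n + 1) hprev hS.1 S.quotient_free
  obtain ⟨hinj, hsurj⟩ := f.isQuasiIso_iff.1 hf
  have h0 : ∀ {a b : ℤ} (h : a + 1 = b) (x : (DGMod.ofGraded N).gr.X a),
      (DGMod.ofGraded N).D.map h x = 0 :=
    fun h x => DGMod.ofD_D _ _ _ h x
  have hfD : ∀ {a b} (h : a + 1 = b) x, f.map b (F.D.map h x) = 0 := fun h x => by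
    rw [f.map_D, h0]
  have hsurj' : ∀ a n, ∃ x, f.map a x = n ∧ ∀ b (h : a + 1 = b), F.D.map h x = 0 := by
    intro a n
    obtain ⟨x, hx, y, hy⟩ := hsurj (sub_add_cancel a 1) rfl n (h0 _ _)
    rw [h0, eq_comm, sub_eq_zero] at hy
    exact ⟨x, hy.symm, by rintro b rfl; exact hx⟩
  have hinj' : ∀ {a b c} (h : a + 1 = b) (h' : b + 1 = c) x, F.D.map h' x = 0 → f.map b x = 0 →
      ∃ y, F.D.map h y = x := fun h h' x hx hfx => hinj h h' x hx ⟨0, by rw [hfx, map_zero]⟩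
  obtain ⟨T₀⟩ := SyzygyComparison.initial (D := F.D)
    (G := fun p => (DGSubmod.prev S.sub p).gr) (fun i x hx => hx) f.toGradedModHom hfD hsurj' hinj'
  exact T₀.hasProjRes T (fun m _ => hT m) F.D_D f.toGradedModHom hsurj' hinj' n 0 0 N (by omega)

/-! ### Cones and semi-free resolutions built from free resolutions of cohomology -/

namespace GradedMod

/-- The direct sum of two graded modules. -/
def prod (M N : GradedMod A) : GradedMod A where
  X := fun i => M.X i × N.X i
  smul := fun {_ _ _} h =>
    LinearMap.mk₂ k (fun a m => (M.smul h a m.1, N.smul h a m.2))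
      (by intro a a' m; simp)
      (by intro c a m; simp)
      (by intro a m m'; simp)
      (by intro c a m; simp)
  one_smul := fun m => Prod.ext (M.one_smul m.1) (N.one_smul m.2)
  mul_smul := fun hp hr hq hr' a b m =>
    Prod.ext (M.mul_smul hp hr hq hr' a b m.1) (N.mul_smul hp hr hq hr' a b m.2)

/-- The first projection. -/
def fst (M N : GradedMod A) : GradedModHom (M.prod N) M where
  map := fun _ => LinearMap.fst k _ _
  map_smul := fun _ _ _ => rfl

/-- The second projection. -/
def snd (M N : GradedMod A) : GradedModHom (M.prod N) N where
  map := fun _ => LinearMap.snd k _ _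
  map_smul := fun _ _ _ => rfl

theorem prod_ext (M N : GradedMod A) {i : ℤ} {x y : (M.prod N).X i}
    (h₁ : (M.fst N).map i x = (M.fst N).map i y)
    (h₂ : (M.snd N).map i x = (M.snd N).map i y) : x = y :=
  Prod.ext h₁ h₂

/-- The shift of a graded module. -/
def shift (M : GradedMod A) : GradedMod A where
  X := fun i => M.X (i + 1)
  smul := fun {i j l} h => M.smul (show i + (j + 1) = l + 1 by omega)
  one_smul := fun m => M.one_smul m
  mul_smul := fun hp _ _ _ a b m => M.mul_smul hp _ _ _ a b m

/-- The shift as a map of degree `1`. -/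
def unshift (M : GradedMod A) : DegHom 1 M.shift M where
  map := fun {i j} h => (M.smul (show 0 + (i + 1) = j by omega) A.one : M.X (i + 1) →ₗ[k] M.X j)
  map_smul := by
    intro i j l j' l' h hj hl h' a m
    subst hj hl
    exact (M.one_smul _).trans (congrArg _ (M.one_smul _).symm)

theorem unshift_bijective (M : GradedMod A) {i j : ℤ} (h : i + 1 = j) :
    Bijective (M.unshift.map h) := by
  subst h
  refine ⟨fun x y hxy => ?_, fun x => ⟨x, M.one_smul x⟩⟩
  exact (M.one_smul (i := i + 1) x).symm.trans (hxy.trans (M.one_smul _))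

end GradedMod

/-- The map to a direct sum with given components. -/
def DegHom.pair {p : ℤ} {M N P : GradedMod A} (f : DegHom p M N) (g : DegHom p M P) :
    DegHom p M (N.prod P) where
  map := fun h => (f.map h).prod (g.map h)
  map_smul := fun h hj hl h' a m =>
    Prod.ext (f.map_smul h hj hl h' a m) (g.map_smul h hj hl h' a m)

@[simp] theorem DegHom.fst_pair {p : ℤ} {M N P : GradedMod A} (f : DegHom p M N)
    (g : DegHom p M P) {i j : ℤ} (h : i + p = j) (x : M.X i) :
    (N.fst P).map j ((f.pair g).map h x) = f.map h x := rfl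

@[simp] theorem DegHom.snd_pair {p : ℤ} {M N P : GradedMod A} (f : DegHom p M N)
    (g : DegHom p M P) {i j : ℤ} (h : i + p = j) (x : M.X i) :
    (N.snd P).map j ((f.pair g).map h x) = g.map h x := rfl

/-- The sum of two morphisms. -/
def GradedModHom.add {M N : GradedMod A} (f g : GradedModHom M N) : GradedModHom M N where
  map := fun i => f.map i + g.map i
  map_smul := by
    intro i j l h a m
    simp [f.map_smul h, g.map_smul h]

@[simp] theorem GradedModHom.add_map {M N : GradedMod A} (f g : GradedModHom M N) (i : ℤ)
    (x : M.X i) : (f.add g).map i x = f.map i x + g.map i x := rfl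

namespace DGMod

/-- The graded submodule of cocycles. -/
def cyc (M : DGMod A.toDG) : GradedSubmod M.gr where
  X := fun i => LinearMap.ker (M.D.map (rfl : i + 1 = i + 1))
  smul_mem := by
    intro i j l h a m hm
    rw [LinearMap.mem_ker] at hm ⊢
    rw [M.D.map_smul h rfl rfl (by omega), hm, map_zero]

theorem mem_cyc (M : DGMod A.toDG) {i j : ℤ} (h : i + 1 = j) (x : M.gr.X i) :
    x ∈ M.cyc.X i ↔ M.D.map h x = 0 := by
  subst h
  rfl

theorem D_cyc (M : DGMod A.toDG) {i j : ℤ} (h : i + 1 = j) (x : M.cyc.toMod.X i) :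
    M.D.map h (M.cyc.incl.map i x) = 0 := (M.mem_cyc h _).1 (M.cyc.incl_mem x)

/-- The graded submodule of coboundaries. -/
def bd (M : DGMod A.toDG) : GradedSubmod M.gr where
  X := fun i => LinearMap.range (M.D.map (sub_add_cancel i 1))
  smul_mem := by
    rintro i j l h a _ ⟨m, rfl⟩
    exact ⟨M.smul (show i + (j - 1) = l - 1 by omega) a m, M.D.map_smul _ _ _ _ _ _⟩

theorem mem_bd (M : DGMod A.toDG) {i j : ℤ} (h : j + 1 = i) (x : M.gr.X i) :
    x ∈ M.bd.X i ↔ ∃ y, M.D.map h y = x := by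
  obtain rfl : j = i - 1 := by omega
  rfl

/-- The graded module `N` is the cohomology of `M` up to a shift by `p`. -/
structure IsCohomology (M : DGMod A.toDG) (p : ℤ) (N : GradedMod A) where
  η : DegHom p M.cyc.toMod N
  surj : ∀ {i j} (h : i + p = j), Surjective (η.map h)
  ker : ∀ {i j} (h : i + p = j) x, η.map h x = 0 ↔ M.cyc.incl.map i x ∈ M.bd.X i

/-- The cohomology of `M` as a graded module. -/
def cohomologyMod (M : DGMod A.toDG) : GradedMod A := (M.bd.comap M.cyc.incl).quot

/-- The graded module `H(M)` is the cohomology of `M`. -/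
def isCohomology (M : DGMod A.toDG) : M.IsCohomology 0 M.cohomologyMod where
  η := (M.bd.comap M.cyc.incl).proj.toDegHom
  surj := by
    intro i j h
    obtain rfl : i = j := by omega
    intro x
    obtain ⟨y, rfl⟩ := (M.bd.comap M.cyc.incl).proj_surjective i x
    exact ⟨y, GradedModHom.toDegHom_map _ h y⟩
  ker := by
    intro i j h x
    obtain rfl : i = j := by omega
    refine Eq.congr_left (GradedModHom.toDegHom_map _ h x) |>.trans ?_
    exact GradedSubmod.proj_eq_zero _ _

/-- `F` has a semi-free filtration with `r` steps. -/
def HasCells (F : DGMod A.toDG) (r : ℕ) : Prop :=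
  ∃ S : ℕ → DGSubmod F, S 0 = DGSubmod.zero F ∧ S r = DGSubmod.whole F ∧
    (∀ p < r, ∀ i, (S p).X i ≤ (S (p + 1)).X i) ∧
    ∀ p < r, DGSubmod.QuotientIsDGFree (S p) (S (p + 1))

section Cone

variable {M : DGMod A.toDG} {L : GradedMod A}

/-- The differential of the cone of a morphism from a graded module with zero differential. -/
def coneD (M : DGMod A.toDG) (f : GradedModHom L M.gr) :
    DegHom 1 (M.gr.prod L.shift) (M.gr.prod L.shift) :=
  DegHom.pair ((M.D.precomp (M.gr.fst L.shift)).add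
    ((DegHom.postcomp f L.unshift).precomp (M.gr.snd L.shift))) (DegHom.zero _ _ _)

/-- The cone of a morphism from a graded module with zero differential. -/
def cone (M : DGMod A.toDG) (f : GradedModHom L M.gr)
    (hf : ∀ {i j : ℤ} (h : i + 1 = j) x, M.D.map h (f.map i x) = 0) : DGMod A.toDG :=
  ofD (M.gr.prod L.shift) (coneD M f) (by
    intro i j l h h' x
    refine GradedMod.prod_ext _ _ ?_ rfl
    simp [coneD, M.D_D, hf])

variable (f : GradedModHom L M.gr)
  (hf : ∀ {i j : ℤ} (h : i + 1 = j) x, M.D.map h (f.map i x) = 0)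

/-- The projection of a cone to `M`. -/
def coneFst : GradedModHom (cone M f hf).gr M.gr := M.gr.fst L.shift

/-- The projection of a cone to `L`. -/
def coneSnd : DegHom 1 (cone M f hf).gr L := L.unshift.precomp (M.gr.snd L.shift)

theorem cone_ext {i j : ℤ} (h : i + 1 = j) {x y : (cone M f hf).gr.X i}
    (h₁ : (coneFst f hf).map i x = (coneFst f hf).map i y)
    (h₂ : (coneSnd f hf).map h x = (coneSnd f hf).map h y) : x = y :=
  Prod.ext h₁ ((L.unshift_bijective h).1 h₂)

theorem exists_cone {i j : ℤ} (h : i + 1 = j) (m : M.gr.X i) (l : L.X j) :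
    ∃ z : (cone M f hf).gr.X i, (coneFst f hf).map i z = m ∧ (coneSnd f hf).map h z = l := by
  obtain ⟨l, rfl⟩ := (L.unshift_bijective h).2 l
  exact ⟨(m, l), rfl, rfl⟩

theorem coneFst_D {i j : ℤ} (h : i + 1 = j) (x : (cone M f hf).gr.X i) :
    (coneFst f hf).map j ((cone M f hf).D.map h x) =
      M.D.map h ((coneFst f hf).map i x) + f.map j ((coneSnd f hf).map h x) :=
  congrArg _ (ofD_D _ (coneD M f) _ h x)

theorem coneSnd_D {i j l : ℤ} (h : i + 1 = j) (h' : j + 1 = l) (x : (cone M f hf).gr.X i) :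
    (coneSnd f hf).map h' ((cone M f hf).D.map h x) = 0 :=
  (congrArg ((coneSnd f hf).map h') (ofD_D _ (coneD M f) _ h x)).trans
    (map_zero (L.unshift.map h'))

variable {f hf} {G : DGMod A.toDG} (g : DGModHom G (cone M f hf))

/-- The component in `M` of a morphism to a cone. -/
def toFst : GradedModHom G.gr M.gr := (coneFst f hf).comp g.toGradedModHom

/-- The component in `L` of a morphism to a cone. -/
def toSnd : DegHom 1 G.gr L := (coneSnd f hf).precomp g.toGradedModHom

theorem toFst_map {i : ℤ} (x : G.gr.X i) :
    (toFst g).map i x = (coneFst f hf).map i (g.map i x) := rfl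

theorem toSnd_map {i j : ℤ} (h : i + 1 = j) (x : G.gr.X i) :
    (toSnd g).map h x = (coneSnd f hf).map h (g.map i x) := rfl

theorem toFst_D {i j : ℤ} (h : i + 1 = j) (x : G.gr.X i) : (toFst g).map j (G.D.map h x) =
    M.D.map h ((toFst g).map i x) + f.map j ((toSnd g).map h x) := by
  rw [toFst_map, g.map_D, coneFst_D, toFst_map, toSnd_map]

theorem toSnd_D {i j l : ℤ} (h : i + 1 = j) (h' : j + 1 = l) (x : G.gr.X i) :
    (toSnd g).map h' (G.D.map h x) = 0 := by
  rw [toSnd_map, g.map_D, coneSnd_D]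

/-- The differential of the extension of `G` by `L`. -/
def extD : DegHom 1 (G.gr.prod L) (G.gr.prod L) :=
  DegHom.pair (G.D.precomp (G.gr.fst L))
    ((DegHom.zero 1 _ _).sub ((toSnd g).precomp (G.gr.fst L)))

/-- The extension of `G` by `L` defined by a morphism from `G` to a cone on `L`. -/
def ext : DGMod A.toDG :=
  ofD (G.gr.prod L) (extD g) (by
    intro i j l h h' x
    refine GradedMod.prod_ext _ _ ?_ ?_
    · simp [extD, G.D_D]
    · simp [extD, toSnd_D])

/-- The projection of the extension to `G`. -/
def extFst : GradedModHom (ext g).gr G.gr := G.gr.fst L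

/-- The projection of the extension to `L`. -/
def extSnd : GradedModHom (ext g).gr L := G.gr.snd L

theorem ext_ext {i : ℤ} {x y : (ext g).gr.X i} (h₁ : (extFst g).map i x = (extFst g).map i y)
    (h₂ : (extSnd g).map i x = (extSnd g).map i y) : x = y :=
  Prod.ext h₁ h₂

theorem exists_ext {i : ℤ} (γ : G.gr.X i) (l : L.X i) :
    ∃ x : (ext g).gr.X i, (extFst g).map i x = γ ∧ (extSnd g).map i x = l :=
  ⟨(γ, l), rfl, rfl⟩

theorem extFst_D {i j : ℤ} (h : i + 1 = j) (x : (ext g).gr.X i) :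
    (extFst g).map j ((ext g).D.map h x) = G.D.map h ((extFst g).map i x) :=
  congrArg _ (ofD_D _ (extD g) _ h x)

theorem extSnd_D {i j : ℤ} (h : i + 1 = j) (x : (ext g).gr.X i) :
    (extSnd g).map j ((ext g).D.map h x) = -(toSnd g).map h ((extFst g).map i x) :=
  (congrArg _ (ofD_D _ (extD g) _ h x)).trans (zero_sub _)

/-- The morphism from the extension to `M`. -/
def extHom : DGModHom (ext g) M :=
  DGModHom.ofD (((toFst g).comp (extFst g)).add (f.comp (extSnd g))) (by
    intro i j h x
    simp only [GradedModHom.add_map, GradedModHom.comp_map]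
    rw [extFst_D, extSnd_D, toFst_D, map_add, hf, map_neg]
    abel)

theorem extHom_map {i : ℤ} (x : (ext g).gr.X i) : (extHom g).map i x =
    (toFst g).map i ((extFst g).map i x) + f.map i ((extSnd g).map i x) := rfl

/-- `M` is, up to quasi-isomorphism, the fibre of the projection from the cone to the shift of `L`.
The extension is the fibre of the composite of `g` with that projection, and `g` is a
quasi-isomorphism. -/
theorem extHom_isQuasiIso (hg : g.IsQuasiIso) : (extHom g).IsQuasiIso := by
  obtain ⟨hinj, hsurj⟩ := g.isQuasiIso_iff.1 hg
  rw [DGModHom.isQuasiIso_iff]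
  constructor
  · rintro a b c h h' x hx ⟨m, hm⟩
    have hx1 : G.D.map h' ((extFst g).map b x) = 0 := by rw [← extFst_D, hx, map_zero]
    have hx2 : (toSnd g).map h' ((extFst g).map b x) = 0 := by
      rw [← neg_eq_zero, ← extSnd_D, hx, map_zero]
    rw [extHom_map] at hm
    -- A primitive `m` of the image of `x`, paired with minus the `L`-component of `x`, is a
    -- primitive in the cone of the image of the `G`-component of `x`.
    obtain ⟨z, hz1, hz2⟩ := exists_cone f hf h m (-(extSnd g).map b x)
    have hz : (cone M f hf).D.map h z = g.map b ((extFst g).map b x) := by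
      refine cone_ext f hf h' ?_ ?_
      · rw [coneFst_D, hz1, hz2, hm, map_neg, add_neg_cancel_right, toFst_map]
      · rw [coneSnd_D, ← toSnd_map, hx2]
    obtain ⟨γ, hγ⟩ := hinj h h' _ hx1 ⟨z, hz⟩
    -- The primitive `γ` in `G` need not have the right component in `L`. It differs from `z` by a
    -- cocycle of the cone, which is the image of a cocycle `γ'` up to a coboundary; `γ - γ'` has
    -- the right component.
    have hcoc : (cone M f hf).D.map h (g.map a γ - z) = 0 := by
      rw [map_sub, ← g.map_D, hγ, hz, sub_self]
    obtain ⟨γ', hγ', w, hw⟩ := hsurj (sub_add_cancel a 1) h _ hcoc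
    have h3 : (toSnd g).map h (γ - γ') = -(extSnd g).map b x := by
      have h4 := coneSnd_D f hf (sub_add_cancel a 1) h w
      rw [hw, map_sub, map_sub, hz2, ← toSnd_map, ← toSnd_map] at h4
      rw [map_sub, ← sub_eq_zero, ← h4]
      abel
    obtain ⟨y, hy1, hy2⟩ := exists_ext g (γ - γ') 0
    refine ⟨y, ext_ext g ?_ ?_⟩
    · rw [extFst_D, hy1, map_sub, hγ, hγ', sub_zero]
    · rw [extSnd_D, hy1, h3, neg_neg]
  · intro a b c h h' m hm
    -- A cocycle `m` of `M` is also a cocycle of the cone, hence comes from `G` up to the boundary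
    -- of some `w`; the `L`-component of `w` completes `γ` to a cocycle of the extension.
    obtain ⟨z, hz1, hz2⟩ := exists_cone f hf h' m 0
    have hz : (cone M f hf).D.map h' z = 0 := by
      refine cone_ext f hf rfl ?_ ?_
      · rw [coneFst_D, hz1, hz2, hm, map_zero, map_zero, add_zero]
      · rw [coneSnd_D, map_zero]
    obtain ⟨γ, hγ, w, hw⟩ := hsurj h h' z hz
    have h1 := coneFst_D f hf h w
    have h2 := coneSnd_D f hf h h' w
    rw [hw, map_sub, hz1, ← toFst_map] at h1
    rw [hw, map_sub, hz2, zero_sub, neg_eq_zero, ← toSnd_map] at h2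
    obtain ⟨y, hy1, hy2⟩ := exists_ext g γ ((coneSnd f hf).map h w)
    refine ⟨y, ext_ext g ?_ ?_, (coneFst f hf).map a w, ?_⟩
    · rw [extFst_D, hy1, hγ, map_zero]
    · rw [extSnd_D, hy1, h2, neg_zero, map_zero]
    · rw [extHom_map, hy1, hy2, ← sub_sub, h1, add_sub_cancel_right]

end Cone

/-- The free module on `Y` is the new bottom layer, and the preimages of the filtration of `G` lie
above it with the same quotients. -/
theorem ext_hasCells {M G : DGMod A.toDG} {Y : Type u} {deg : Y → ℤ}
    {f : GradedModHom (A.free Y deg) M.gr}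
    {hf : ∀ {i j : ℤ} (h : i + 1 = j) x, M.D.map h (f.map i x) = 0}
    (g : DGModHom G (cone M f hf)) {r : ℕ} (hG : G.HasCells r) :
    (ext (hf := hf) g).HasCells (r + 1) := by
  obtain ⟨S, hS0, hSr, hmono, hq⟩ := hG
  let T : DGSubmod G → DGSubmod (ext g) := fun N =>
    { X := fun i => (N.X i).comap ((extFst g).map i)
      smul_mem := by
        intro i j l h a m hm
        change A.X i at a
        change (extFst g).map l ((ext g).gr.smul h a m) ∈ N.X l
        rw [(extFst g).map_smul]
        exact N.smul_mem h a _ hm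
      d_mem := by
        intro i j h m hm
        have := N.d_mem h _ hm
        rw [Submodule.mem_comap, d_eq, Units.smul_def, map_zsmul, extFst_D]
        rw [d_eq, Units.smul_def] at this
        exact this }
  let T' : ℕ → DGSubmod (ext g) := fun p => match p with
    | 0 => DGSubmod.zero _
    | p + 1 => T (S p)
  refine ⟨T', rfl, ?_, ?_, ?_⟩
  · change T (S r) = _
    rw [hSr]
    rfl
  · intro p hp i
    cases p with
    | zero => exact bot_le
    | succ p => exact Submodule.comap_mono (hmono p (by omega) i)
  · intro p hp
    cases p with
    | zero =>
      have h0 : ∀ i (x : (T (S 0)).X i), (extFst g).map i x.1 = 0 := by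
        intro i x
        have h : (S 0).X i = ⊥ := by rw [hS0]; rfl
        exact (Submodule.mem_bot k).1 (h.le x.2)
      refine ⟨Y, deg, { toGradedModHom := (extSnd g).comp (T (S 0)).gr.incl, map_d := ?_ }, ?_, ?_⟩
      · intro i j h m
        rw [GradedAlg.free_d]
        change (extSnd g).map j ((ext g).d h m.1) = 0
        rw [d_eq, Units.smul_def, map_zsmul, extSnd_D]
        exact (congrArg (fun z => (i.negOnePow : ℤ) • -(toSnd g).map h z) (h0 i m)).trans
          (by simp)
      · intro i x
        obtain ⟨y, hy1, hy2⟩ := exists_ext g 0 x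
        refine ⟨⟨y, ?_⟩, hy2⟩
        change (extFst g).map i y ∈ (S 0).X i
        rw [hy1]
        exact zero_mem _
      · intro i x
        constructor
        · intro hx
          exact ext_ext g ((h0 i x).trans (map_zero _).symm) (hx.trans (map_zero _).symm)
        · intro hx
          change (extSnd g).map i x.1 = 0
          rw [show x.1 = 0 from hx, map_zero]
    | succ p =>
      obtain ⟨Y', deg', π, hπ, hπ'⟩ := hq p (by omega)
      let ρ : GradedModHom (T (S (p + 1))).gr.toMod (S (p + 1)).gr.toMod :=
        (S (p + 1)).gr.codRestrict ((extFst g).comp (T (S (p + 1))).gr.incl) fun i x => x.2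
      refine ⟨Y', deg', { toGradedModHom := π.toGradedModHom.comp ρ, map_d := ?_ }, ?_, ?_⟩
      · intro i j h m
        rw [GradedAlg.free_d]
        change π.map j (ρ.map j _) = 0
        refine (congrArg (π.map j) (Subtype.ext ?_)).trans
          ((π.map_d h (ρ.map i m)).trans (GradedAlg.free_d h _))
        change (extFst g).map j ((ext g).d h m.1) = G.d h ((extFst g).map i m.1)
        rw [d_eq, d_eq, Units.smul_def, map_zsmul, extFst_D]
        rfl
      · intro i x
        obtain ⟨γ, rfl⟩ := hπ i x
        obtain ⟨y, hy1, hy2⟩ := exists_ext g γ.1 0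
        have hy : (extFst g).map i y ∈ (S (p + 1)).X i := by
          rw [hy1]
          exact γ.2
        exact ⟨⟨y, hy⟩, congrArg (π.map i) (Subtype.ext hy1)⟩
      · intro i x
        exact hπ' i (ρ.map i x)

end DGMod

namespace GradedAlg

/-- The isomorphism of degree `p` between free modules whose bases differ by a shift by `p`. -/
noncomputable def freeShift (A : GradedAlg.{u} k) {Y : Type u} {d e : Y → ℤ} {p : ℤ}
    (hd : ∀ y, d y + p = e y) : DegHom p (A.free Y d) (A.free Y e) :=
  freeDegHom p hd (freeBasis A e)

theorem freeShift_freeShift {Y : Type u} {d e : Y → ℤ} {p q : ℤ} (hd : ∀ y, d y + p = e y)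
    (he : ∀ y, e y + q = d y) (hpq : p + q = 0) {i j : ℤ} (h : i + p = j) (h' : j + q = i)
    (x : (A.free Y d).X i) : (A.freeShift he).map h' ((A.freeShift hd).map h x) = x := by
  have key := free_degHom_ext ((A.freeShift he).comp (A.freeShift hd) hpq)
    (GradedModHom.id (A.free Y d)).toDegHom (fun y => add_zero (d y)) (fun y => by
      rw [DegHom.comp_map _ _ _ _ (hd y) (he y), GradedModHom.toDegHom_map, freeShift, freeShift,
        freeDegHom_freeBasis, freeDegHom_freeBasis]
      rfl) (add_zero i) x
  rw [DegHom.comp_map _ _ _ _ h h', GradedModHom.toDegHom_map] at key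
  exact key

theorem freeShift_bijective {Y : Type u} {d e : Y → ℤ} {p : ℤ} (hd : ∀ y, d y + p = e y)
    {i j : ℤ} (h : i + p = j) : Bijective ((A.freeShift hd).map h) := by
  have he : ∀ y, e y + -p = d y := fun y => by have := hd y; omega
  have h' : j + -p = i := by omega
  exact ⟨LeftInverse.injective (freeShift_freeShift hd he (by omega) h h'),
    RightInverse.surjective (freeShift_freeShift he hd (by omega) h' h)⟩

end GradedAlg

namespace DGMod

variable {M : DGMod A.toDG} {p : ℤ} {N : GradedMod A}

/-- The cohomology of a cone on a free cover of the cohomology of `M` is a syzygy of the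
cohomology of `M`. -/
theorem exists_cone_isCohomology (H : M.IsCohomology p N) {Y : Type u} {deg : Y → ℤ}
    (φ : GradedModHom (A.free Y deg) N) (hφ : ∀ i, Surjective (φ.map i)) :
    ∃ (d : Y → ℤ) (f : GradedModHom (A.free Y d) M.gr)
      (hf : ∀ {i j : ℤ} (h : i + 1 = j) x, M.D.map h (f.map i x) = 0),
      Nonempty ((cone M f hf).IsCohomology (p + 1) φ.ker) := by
  -- `N` is the cohomology shifted by `p`, so a generator of degree `deg y` of its cover is
  -- represented by a cocycle of degree `deg y - p`.
  have hd : ∀ y, deg y - p + p = deg y := fun y => sub_add_cancel _ _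
  choose z hz using fun y => H.surj (hd y) (φ.map _ (GradedAlg.freeBasis A deg y))
  let fZ : GradedModHom (A.free Y fun y => deg y - p) M.cyc.toMod := GradedAlg.freeHom z
  let f := M.cyc.incl.comp fZ
  have hf : ∀ {i j : ℤ} (h : i + 1 = j) x, M.D.map h (f.map i x) = 0 :=
    fun h x => M.D_cyc h (fZ.map _ x)
  let c := A.freeShift hd
  have hc : ∀ {i j : ℤ} (h : i + p = j) x, H.η.map h (fZ.map i x) = φ.map j (c.map h x) := by
    intro i j h x
    refine GradedAlg.free_degHom_ext (H.η.precomp fZ) (DegHom.postcomp φ c) hd (fun y => ?_) h x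
    rw [DegHom.precomp_map, DegHom.postcomp_map, GradedAlg.freeHom_freeBasis, hz]
    exact congrArg _ (GradedAlg.freeDegHom_freeBasis _ _ _ _).symm
  -- A cocycle of the cone is a pair `(m, l)` with `D m = -f l`. So `l` represents an element of the
  -- kernel of `φ`, and this defines the map to `φ.ker`.
  have hcyc : ∀ {i j : ℤ} (h : i + 1 = j) (x : (cone M f hf).cyc.toMod.X i),
      M.D.map h ((coneFst f hf).map i ((cone M f hf).cyc.incl.map i x)) +
        f.map j ((coneSnd f hf).map h ((cone M f hf).cyc.incl.map i x)) = 0 := by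
    intro i j h x
    rw [← coneFst_D, D_cyc, map_zero]
  have hker : ∀ {i j : ℤ} (h : i + (p + 1) = j) (x : (cone M f hf).cyc.toMod.X i),
      ((c.comp (coneSnd f hf) (add_comm 1 p)).precomp (cone M f hf).cyc.incl).map h x ∈
        φ.kerSub.X j := by
    intro i j h x
    have h1 : i + 1 + p = j := by omega
    change φ.map j _ = 0
    rw [DegHom.precomp_map, DegHom.comp_map _ _ _ _ rfl h1, ← hc, H.ker]
    change f.map _ _ ∈ _
    rw [M.mem_bd (rfl : i + 1 = i + 1), eq_neg_of_add_eq_zero_right (hcyc rfl x)]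
    exact ⟨-(coneFst f hf).map i ((cone M f hf).cyc.incl.map i x), map_neg _ _⟩
  refine ⟨_, f, hf, ⟨⟨((c.comp (coneSnd f hf) (add_comm 1 p)).precomp
    (cone M f hf).cyc.incl).codRestrict φ.kerSub hker, ?_, ?_⟩⟩⟩
  · intro i j h y
    have h1 : i + 1 + p = j := by omega
    obtain ⟨l, hl⟩ := (GradedAlg.freeShift_bijective hd h1).2 (φ.kerι.map j y)
    have h2 := hc h1 l
    rw [show c.map h1 l = _ from hl, φ.map_kerι, H.ker, M.mem_bd (rfl : i + 1 = i + 1)] at h2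
    obtain ⟨m, hm⟩ := h2
    obtain ⟨w, hw1, hw2⟩ := exists_cone f hf rfl (-m) l
    have hw : (cone M f hf).D.map (rfl : i + 1 = i + 1) w = 0 := by
      refine cone_ext f hf rfl ?_ ?_
      · rw [coneFst_D, hw1, hw2, map_neg, hm, map_zero]
        exact neg_add_cancel _
      · rw [coneSnd_D, map_zero]
    obtain ⟨w, rfl⟩ : ∃ w', (cone M f hf).cyc.incl.map i w' = w := ⟨⟨w, hw⟩, rfl⟩
    refine ⟨w, φ.kerSub.incl_injective j ((DegHom.comp_map c (coneSnd f hf) (add_comm 1 p) h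
      (rfl : i + 1 = i + 1) h1 _).trans ?_)⟩
    exact (congrArg (c.map h1) hw2).trans hl
  · intro i j h x
    have h1 : i + 1 + p = j := by omega
    rw [← map_eq_zero_iff _ (φ.kerSub.incl_injective j), DegHom.incl_codRestrict,
      DegHom.precomp_map, DegHom.comp_map _ _ _ _ rfl h1,
      map_eq_zero_iff _ (GradedAlg.freeShift_bijective hd h1).1,
      (cone M f hf).mem_bd (sub_add_cancel i 1)]
    constructor
    · intro hx
      have h2 := hcyc rfl x
      rw [hx, map_zero, add_zero] at h2
      obtain ⟨m, hm⟩ : ∃ m, M.cyc.incl.map i m =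
        (coneFst f hf).map i ((cone M f hf).cyc.incl.map i x) := ⟨⟨_, h2⟩, rfl⟩
      have h3 : i + p = j - 1 := by omega
      -- A cocycle of the cone of the form `(m, 0)` is a boundary: the class of `m` is hit by the
      -- cover, so `m` is `f l` plus a coboundary of `M`.
      obtain ⟨b, hb⟩ := hφ _ (H.η.map h3 m)
      obtain ⟨l, hl⟩ := (GradedAlg.freeShift_bijective (A := A) hd h3).2 b
      have h4 : H.η.map h3 (m - fZ.map i l) = 0 := by
        rw [map_sub, hc, show c.map h3 l = b from hl, hb, sub_self]
      rw [H.ker, M.mem_bd (sub_add_cancel i 1)] at h4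
      obtain ⟨m', hm'⟩ := h4
      obtain ⟨w, hw1, hw2⟩ := exists_cone f hf (sub_add_cancel i 1) m' l
      refine ⟨w, cone_ext f hf rfl ?_ ?_⟩
      · rw [coneFst_D, hw1, hw2, hm', ← hm, map_sub]
        exact sub_add_cancel _ _
      · rw [coneSnd_D, hx]
    · rintro ⟨w, hw⟩
      rw [← hw, coneSnd_D]

/-- A DG module whose cohomology has a free resolution with `r` terms is quasi-isomorphic to a
semi-free DG module that is built in `r` steps. -/
theorem exists_hasCells : ∀ {r : ℕ} {N : GradedMod A}, N.HasFreeRes r →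
    ∀ {M : DGMod A.toDG} {p : ℤ}, M.IsCohomology p N →
      ∃ (F : DGMod A.toDG) (f : DGModHom F M), F.HasCells r ∧ f.IsQuasiIso
  | 0, N, hN, M, p, H => by
    let F : DGMod A.toDG := ofGraded (GradedMod.zero A)
    have hF : DGSubmod.zero F = DGSubmod.whole F :=
      DGSubmod.ext (funext fun i => Subsingleton.elim (h := (inferInstance :
        Subsingleton (Submodule k PUnit.{u + 1}))) _ _)
    refine ⟨F, DGModHom.ofD (GradedModHom.zero _ _) fun h x => ?_, ⟨fun _ => DGSubmod.zero F,
      rfl, hF, by omega, by omega⟩, ?_⟩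
    · exact (map_zero (M.D.map h)).symm
    · rw [DGModHom.isQuasiIso_iff]
      refine ⟨fun h h' x _ _ => ⟨0, rfl⟩, fun {a b c} h h' m hm => ⟨0, rfl, ?_⟩⟩
      obtain ⟨m, rfl⟩ : ∃ m', M.cyc.incl.map b m' = m := ⟨⟨m, (M.mem_cyc h' m).2 hm⟩, rfl⟩
      have := hN (b + p)
      obtain ⟨y, hy⟩ := (M.mem_bd h _).1 ((H.ker rfl m).1 (Subsingleton.elim _ _))
      exact ⟨y, hy.trans (sub_zero _).symm⟩
  | r + 1, N, ⟨Y, deg, φ, hφ, hK⟩, M, p, H => by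
    obtain ⟨d, f, hf, ⟨H'⟩⟩ := exists_cone_isCohomology H φ hφ
    obtain ⟨G, g, hG, hg⟩ := exists_hasCells hK H'
    exact ⟨ext g, extHom g, ext_hasCells g hG, extHom_isQuasiIso g hg⟩

end DGMod

/-- The zero module is free on the empty set; this allows a finite filtration to be continued by
constant terms. -/
theorem DGSubmod.quotientIsDGFree_refl {M : DGMod A.toDG} (N : DGSubmod M) :
    N.QuotientIsDGFree N := by
  have hz : ∀ i (x : (A.toDG.free PEmpty fun _ => 0).X i), x = 0 := fun i x =>
    DFinsupp.ext fun y => y.elim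
  exact ⟨PEmpty, fun _ => 0, ⟨GradedModHom.zero _ _, fun _ _ => (hz _ _).trans (hz _ _).symm⟩,
    fun i x => ⟨0, (hz _ _).trans (hz _ _).symm⟩, fun i x => ⟨fun _ => x.2, fun _ => rfl⟩⟩

/-! ### Strict filtrations and comparison of the dimensions -/

namespace DGMod

variable {F : DGMod A.toDG} {r : ℕ}

/-- With the least possible number of steps no term can be repeated and none before the last is all
of `F`, since deleting or truncating would shorten the filtration. The index shift `F(q) = S(q+1)`
gives length `r - 1`, where truncated subtraction covers the zero module, `r = 0`. -/
theorem exists_filtration_of_hasCells_minimal (h : F.HasCells r)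
    (hmin : ∀ s < r, ¬ F.HasCells s) :
    ∃ S : SemifreeFiltration F, S.IsStrict ∧ S.HasLength (r - 1) := by
  obtain ⟨S, h0, hr, hmono, hq⟩ := h
  have hprev : ∀ q, DGSubmod.prev (fun q => S (min (q + 1) r)) q = S (min q r) := by
    intro q
    cases q with
    | zero => exact (h0.symm.trans (by rw [Nat.zero_min]))
    | succ q => rfl
  have htrunc : ∀ q < r, S q ≠ DGSubmod.whole F := fun q hqr hS =>
    hmin q hqr ⟨S, h0, hS, fun p hp => hmono p (by omega), fun p hp => hq p (by omega)⟩
  have hdel : ∀ q < r, S q ≠ S (q + 1) := by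
    intro q hqr hS
    obtain ⟨s, rfl⟩ : ∃ s, r = s + 1 := ⟨r - 1, by omega⟩
    -- After the repeated term `S (q + 1)` is deleted, consecutive terms are still consecutive terms
    -- of the old sequence.
    have key : ∀ p < s, ∃ p' < s + 1, (if p ≤ q then S p else S (p + 1)) = S p' ∧
        (if p + 1 ≤ q then S (p + 1) else S (p + 1 + 1)) = S (p' + 1) := by
      intro p hp
      rcases lt_trichotomy p q with h | rfl | h
      · exact ⟨p, by omega, if_pos h.le, if_pos h⟩
      · exact ⟨p + 1, by omega, (if_pos le_rfl).trans hS, if_neg (by omega)⟩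
      · exact ⟨p + 1, by omega, if_neg (by omega), if_neg (by omega)⟩
    refine hmin s (by omega) ⟨fun p => if p ≤ q then S p else S (p + 1), ?_, ?_, ?_, ?_⟩
    · exact (if_pos (Nat.zero_le _)).trans h0
    · change (if s ≤ q then S s else S (s + 1)) = _
      split_ifs with hsq
      · obtain rfl : s = q := by omega
        exact hS.trans hr
      · exact hr
    · intro p hp i
      obtain ⟨p', hp', h1, h2⟩ := key p hp
      change (ite _ _ _ : DGSubmod F).X i ≤ (ite _ _ _ : DGSubmod F).X i
      rw [h1, h2]
      exact hmono p' hp' i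
    · intro p hp
      obtain ⟨p', hp', h1, h2⟩ := key p hp
      change DGSubmod.QuotientIsDGFree (ite _ _ _) (ite _ _ _)
      rw [h1, h2]
      exact hq p' hp'
  refine ⟨⟨fun q => S (min (q + 1) r), ?_, ?_, ?_⟩, ?_, ?_, ?_⟩
  · intro q i
    rcases lt_or_ge (q + 1) r with h | h
    · rw [min_eq_left h.le, min_eq_left h]
      exact hmono _ h i
    · rw [min_eq_right h, min_eq_right (h.trans (Nat.le_succ _))]
  · intro i x
    refine ⟨r, ?_⟩
    rw [min_eq_right (Nat.le_succ r), hr]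
    trivial
  · intro q
    rw [hprev]
    rcases lt_or_ge q r with h | h
    · rw [min_eq_left h.le, min_eq_left h]
      exact hq q h
    · rw [min_eq_right h, min_eq_right (h.trans (Nat.le_succ _))]
      exact DGSubmod.quotientIsDGFree_refl _
  · intro q hne
    change DGSubmod.prev (fun q => S (min (q + 1) r)) q ≠ S (min (q + 1) r)
    have hne' : DGSubmod.prev (fun q => S (min (q + 1) r)) q ≠ _ := hne
    rw [hprev] at hne' ⊢
    have hqr : q < r := by
      by_contra h
      rw [min_eq_right (not_lt.1 h)] at hne'
      exact hne' hr
    rw [min_eq_left hqr.le, min_eq_left hqr]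
    exact hdel q hqr
  · change S (min (r - 1 + 1) r) = _
    rw [min_eq_right (by omega), hr]
  · intro m hm
    change S (min (m + 1) r) ≠ _
    rw [min_eq_left (by omega)]
    exact htrunc _ (by omega)

theorem HasCells.isSemifree_and_dgFreeClass_le {n : ℕ} (h : F.HasCells r) (hr : r ≤ n + 1) :
    F.IsSemifree ∧ F.dgFreeClass ≤ n := by
  classical
  have hex : ∃ r, F.HasCells r := ⟨r, h⟩
  obtain ⟨S, hS, hS'⟩ := exists_filtration_of_hasCells_minimal (Nat.find_spec hex)
    fun s hs => Nat.find_min hex hs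
  have hle : Nat.find hex ≤ r := Nat.find_min' hex h
  refine ⟨⟨S⟩, (iInf₂_le (Nat.find hex - 1) ⟨S, hS, hS'⟩).trans ?_⟩
  exact_mod_cast (show Nat.find hex - 1 ≤ n by omega)

theorem coneLength_le_of_hasFreeRes {M : DGMod A.toDG} {n : ℕ}
    (h : M.cohomologyMod.HasFreeRes (n + 1)) : M.coneLength ≤ n := by
  obtain ⟨F, f, hF, hf⟩ := exists_hasCells h M.isCohomology
  obtain ⟨h1, h2⟩ := hF.isSemifree_and_dgFreeClass_le le_rfl
  exact (iInf₂_le F ⟨h1, f, hf⟩).trans h2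

end DGMod

theorem GradedMod.projDim_le_of_coneLength_le {N : GradedMod A} {n : ℕ}
    (h : (DGMod.ofGraded N).coneLength ≤ n) : N.projDim ≤ n := by
  have hlt : (DGMod.ofGraded N).coneLength < (n + 1 : ℕ) :=
    h.trans_lt (by exact_mod_cast Nat.lt_succ_self n)
  obtain ⟨F, hF⟩ := iInf_lt_iff.1 hlt
  obtain ⟨⟨-, f, hf⟩, hF⟩ := iInf_lt_iff.1 hF
  obtain ⟨m, hm⟩ := iInf_lt_iff.1 hF
  obtain ⟨⟨S, -, hS⟩, hm⟩ := iInf_lt_iff.1 hm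
  have hmn : m ≤ n := Nat.lt_succ_iff.1 (by exact_mod_cast hm)
  exact ((N.projDim_le_iff m).2 (S.hasProjRes hS f hf)).trans (by exact_mod_cast hmn)

theorem ENat.eq_of_forall_le_natCast_iff {a b : ℕ∞} (h : ∀ n : ℕ, a ≤ n ↔ b ≤ n) : a = b := by
  apply le_antisymm
  · induction b using ENat.recTopCoe with
    | top => exact le_top
    | coe n => exact (h n).2 le_rfl
  · induction a using ENat.recTopCoe with
    | top => exact le_top
    | coe n => exact (h n).1 le_rfl

/-- One inequality tests on graded modules with zero differential. The other resolves the cohomology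
of a DG module, and connectedness enters there, in replacing projective resolutions by free ones. -/
theorem GradedAlg.IsConnected.lGlDim_toDG (hA : A.IsConnected) : A.toDG.lGlDim = A.glDim := by
  refine ENat.eq_of_forall_le_natCast_iff fun n => ⟨fun h => ?_, fun h => ?_⟩
  · exact iSup_le fun N => GradedMod.projDim_le_of_coneLength_le ((le_iSup _ _).trans h)
  · exact iSup_le fun M => DGMod.coneLength_le_of_hasFreeRes
      (GradedMod.hasFreeRes_of_hasProjRes hA ((A.glDim_le_iff n).1 h) _)

theorem DGAlg.toDG_toGradedAlg (A : DGAlg.{u} k)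
    (hd : ∀ {i j : ℤ} (h : i + 1 = j) (a : A.X i), A.d h a = 0) : A.toGradedAlg.toDG = A := by
  obtain ⟨B, d, _, _⟩ := A
  have : @d = fun _ _ _ => 0 := by
    funext i j h
    exact LinearMap.ext fun a => hd h a
  subst this
  rfl

end

/-- For a connected DG algebra `A` with zero differential, the left and the right DG global
dimension agree with the graded global dimension of `A^#` (on the left as well as on the right,
that is, over `(A^op)^#`). -/
theorem mainTheorem10 {k : Type v} [Field k] (A : DGAlg.{u} k) (hA : A.IsConnected)
    (hd : ∀ {i j : ℤ} (h : i + 1 = j) (a : A.X i), A.d h a = 0) :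
    A.lGlDim = A.toGradedAlg.glDim ∧ A.toGradedAlg.glDim = A.rGlDim ∧
      A.op.toGradedAlg.glDim = A.toGradedAlg.glDim := by
  have hA' : A.toGradedAlg.IsConnected := hA
  have hop : A.op.toGradedAlg.glDim = A.toGradedAlg.glDim := hA'.glDim_op
  refine ⟨?_, ?_, hop⟩
  · rw [← hA'.lGlDim_toDG, A.toDG_toGradedAlg hd]
  · rw [← hop]
    change _ = A.op.lGlDim
    exact hA'.op.lGlDim_toDG.symm.trans
      (congrArg DGAlg.lGlDim (DGAlg.toDG_toGradedAlg A.op fun h a => hd h a))
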